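/- Theorem (Information-theoretic lower bound for the general complex sensing model). Let $p(y\mid r)\ge 0$ ($r\ge 0$, $y\in\mathbb R$) be jointly measurable with $\int_{\mathbb R}p(y\mid r)\,dy=1$ for every $r\ge 0$. For $m\in[0,1]$ let $$f(m)=\int_{\mathbb R}\frac{\mathbb E\{p(y\mid|G_1|)\,p(y\mid|G_2|)\}}{\mathbb E\{p(y\mid|G|)\}}\,dy\in[0,\infty],$$ where $G\sim\mathsf{CN}(0,1)$ and $(G_1,G_2)$ is centered circularly-symmetric complex Gaussian with $\mathbb E|G_1|^2=\mathbb E|G_2|^2=1$ and $\mathbb E[G_1\overline{G_2}]=c$, $|c|^2=m$ (the value depends only on $m$; $0/0=0$). For $\delta>0$ put $F_\delta(m)=\delta\log f(m)+\log(1-m)\in[-\infty,\infty]$ (with $\log 0=-\infty$, $\log\infty=\infty$ and $\infty+(-\infty)=-\infty$, so that $F_\delta(1)=-\infty$), and $$\delta_\ell=\sup\{\delta>0 : F_\delta(m)<0 \text{ for all } m\in(0,1]\}\in[0,\infty].$$ For $d,n\ge1$ let $X$ be uniform on the sphere of radius $\sqrt d$ in $\mathbb C^d$, let $A_1,\dots,A_{n+1}$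 be i.i.d. $\mathsf{CN}(0,I_d/d)$, independent of $X$, and, given $X$ and $A_1,\dots,A_{n+1}$, let $Y_1,\dots,Y_n$ be independent real random variables, $Y_i$ with density $p(\cdot\mid|\langle X,A_i\rangle|)$. Let $\varphi:\mathbb R\to\mathbb R$ be bounded and measurable, $\phi(r)=\int_{\mathbb R}\varphi(y)\,p(y\mid r)\,dy$, and $Z=\phi(|\langle X,A_{n+1}\rangle|)$. Define the minimum mean square errors $$\mathsf{MMSE}_n=\mathbb E\bigl\{(Z-\mathbb E\{Z\mid Y_1,\dots,Y_n,A_1,\dots,A_n\})^2\bigr\},\qquad \mathsf{MMSE}^{+}_n=\mathbb E\bigl\{(Z-\mathbb E\{Z\mid Y_1,\dots,Y_n,A_1,\dots,A_n,A_{n+1}\})^2\bigr\},$$ where in the second one the estimator also knows the new sensing vector. Let $0<\delta<\delta_\ell$ and let $d=d_n$ satisfy $n/d_n\to\delta$ as $n\to\infty$. Then $\mathrm{Var}\{Z\}$ has the same value $\mathrm{Var}\{\phi(|G|)\}$, $G\sim\mathsf{CN}(0,1)$, for all $d,n\geq 1$, and $$\lim_{n\to\infty}\mathsf{MMSE}_n=\mathrm{Var}\{\phi(|\langle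 X,A_{n+1}\rangle|)\},\qquad \lim_{n\to\infty}\mathsf{MMSE}^{+}_n=\mathrm{Var}\{\phi(|\langle X,A_{n+1}\rangle|)\}.$$ -/

import Mathlib

open MeasureTheory ProbabilityTheory Filter Topology
open scoped NNReal ENNReal

noncomputable section

namespace PhaseSensing

/-- A measurement channel `p(y ∣ r)`, `r ≥ 0`, `y ∈ ℝ`, written `p r y`: a jointly measurable
family of probability densities on the real line. -/
structure IsChannel (p : ℝ≥0 → ℝ → ℝ≥0) : Prop where
  measurable : Measurable (Function.uncurry p)
  lintegral_eq_one : ∀ r, ∫⁻ y, (p r y : ℝ≥0∞) = 1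

/-- The circularly-symmetric complex normal law `CN(0, v)`: the real and imaginary parts are
independent, centered Gaussian with variance `v / 2`. -/
def complexNormal (v : ℝ≥0) : Measure ℂ :=
  ((gaussianReal 0 (v / 2)).prod (gaussianReal 0 (v / 2))).map
    (fun z => (⟨z.1, z.2⟩ : ℂ))

/-- The circularly-symmetric complex normal law of a pair `(G₁, G₂)` with `E|G₁|² = E|G₂|² = 1` and
`E[G₁ conj G₂] = c`, `|c| ≤ 1`: the image of two independent `CN(0, 1)` variables under the linear
map `(z₁, z₂) ↦ (z₁, conj c · z₁ + √(1 - |c|²) · z₂)`. -/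
def complexNormalPair (c : ℂ) : Measure (ℂ × ℂ) :=
  ((complexNormal 1).prod (complexNormal 1)).map
    (fun z => (z.1, (starRingEnd ℂ) c * z.1 + (Real.sqrt (1 - ‖c‖ ^ 2) : ℂ) * z.2))

/-- `f(m) = ∫ E[p(y ∣ |G₁|) p(y ∣ |G₂|)] / E[p(y ∣ |G|)] dy ∈ [0, ∞]`, where `(G₁, G₂)` has
correlation `c` with `|c|² = m`; the value depends on `c` only through `|c|²`, and `c = √m` is used.
Where the denominator vanishes, so does the numerator, and the integrand is `0`. -/
def f (p : ℝ≥0 → ℝ → ℝ≥0) (m : ℝ) : ℝ≥0∞ :=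
  ∫⁻ y, (∫⁻ z, (p ‖z.1‖₊ y : ℝ≥0∞) * (p ‖z.2‖₊ y : ℝ≥0∞)
      ∂(complexNormalPair ((Real.sqrt m : ℝ) : ℂ)))
    / (∫⁻ g, (p ‖g‖₊ y : ℝ≥0∞) ∂(complexNormal 1))

/-- `F_δ(m) = δ log f(m) + log (1 - m)`, in the extended reals, with `log 0 = -∞`, `log ∞ = ∞` (and
`∞ + (-∞) = -∞`, which only matters at `m = 1`). -/
def F (p : ℝ≥0 → ℝ → ℝ≥0) (δ m : ℝ) : EReal :=
  (δ : EReal) * ENNReal.log (f p m) + ENNReal.log (ENNReal.ofReal (1 - m))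

/-- The threshold `δ_ℓ ∈ [0, ∞]`: the supremum of the `δ > 0` such that `F_δ < 0` on `(0, 1]`. -/
def deltaL (p : ℝ≥0 → ℝ → ℝ≥0) : ℝ≥0∞ :=
  sSup {t : ℝ≥0∞ | ∃ δ : ℝ, 0 < δ ∧ (∀ m ∈ Set.Ioc (0 : ℝ) 1, F p δ m < 0) ∧ t = ENNReal.ofReal δ}

/-- Normalized surface measure on the unit sphere of `ℂ^d`. -/
def unitSphereUnif (d : ℕ) : Measure (Metric.sphere (0 : EuclideanSpace ℂ (Fin d)) 1) :=
  ((volume : Measure (EuclideanSpace ℂ (Fin d))).toSphere Set.univ)⁻¹ •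
    (volume : Measure (EuclideanSpace ℂ (Fin d))).toSphere

/-- The uniform distribution on the sphere of radius `√d` in `ℂ^d`. -/
def signalLaw (d : ℕ) : Measure (EuclideanSpace ℂ (Fin d)) :=
  (unitSphereUnif d).map
    (fun u : Metric.sphere (0 : EuclideanSpace ℂ (Fin d)) 1 =>
      ((Real.sqrt d : ℝ) : ℂ) • (u : EuclideanSpace ℂ (Fin d)))

/-- The law `CN(0, I_d / d)` of a sensing vector. -/
def sensingLaw (d : ℕ) : Measure (EuclideanSpace ℂ (Fin d)) :=
  (Measure.pi (fun _ : Fin d => complexNormal ((d : ℝ≥0)⁻¹))).map (WithLp.toLp 2)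

/-- Outcomes `(x, (a_1, …, a_{n+1}), (y_1, …, y_n))`: the signal, the `n + 1` sensing vectors and
the `n` measurements. -/
abbrev Outcome (d n : ℕ) : Type :=
  EuclideanSpace ℂ (Fin d) × (Fin (n + 1) → EuclideanSpace ℂ (Fin d)) × (Fin n → ℝ)

/-- `|⟨x, a⟩|`. -/
def absInner {d : ℕ} (x a : EuclideanSpace ℂ (Fin d)) : ℝ≥0 := ‖inner ℂ a x‖₊

/-- The joint law of `(X, (A_1, …, A_{n+1}), (Y_1, …, Y_n))`: the signal and the sensing vectors are
independent with the laws above, and, given them, the `Y_i` are independent, with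
densities `p(· ∣ |⟨X, A_i⟩|)`. -/
def model (p : ℝ≥0 → ℝ → ℝ≥0) (d n : ℕ) : Measure (Outcome d n) :=
  ((signalLaw d).prod
      ((Measure.pi (fun _ : Fin (n + 1) => sensingLaw d)).prod
        (volume : Measure (Fin n → ℝ)))).withDensity
    (fun ω => ∏ i : Fin n, (p (absInner ω.1 (ω.2.1 i.castSucc)) (ω.2.2 i) : ℝ≥0∞))

/-- `φ(r) = ∫ ϕ(y) p(y ∣ r) dy`. -/
def smoothed (p : ℝ≥0 → ℝ → ℝ≥0) (ϕ : ℝ → ℝ) (r : ℝ≥0) : ℝ :=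
  ∫ y, ϕ y * (p r y : ℝ)

/-- The quantity to be estimated, `φ(|⟨X, A_{n+1}⟩|)`. -/
def target (p : ℝ≥0 → ℝ → ℝ≥0) (ϕ : ℝ → ℝ) (d n : ℕ) (ω : Outcome d n) : ℝ :=
  smoothed p ϕ (absInner ω.1 (ω.2.1 (Fin.last n)))

/-- The data `(Y, A_1, …, A_n)`. -/
def pastData (d n : ℕ) (ω : Outcome d n) :
    (Fin n → ℝ) × (Fin n → EuclideanSpace ℂ (Fin d)) :=
  (ω.2.2, fun i => ω.2.1 i.castSucc)

/-- The data `(Y, A_1, …, A_n)` together with the new sensing vector `A_{n+1}`. -/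
def fullData (d n : ℕ) (ω : Outcome d n) :
    (Fin n → ℝ) × (Fin (n + 1) → EuclideanSpace ℂ (Fin d)) :=
  (ω.2.2, ω.2.1)

/-- The minimum mean square error of estimating `φ(|⟨X, A_{n+1}⟩|)` from the observation `obs`:
the mean square error of the conditional expectation given `obs`. -/
def mmse (p : ℝ≥0 → ℝ → ℝ≥0) (ϕ : ℝ → ℝ) (d n : ℕ) {β : Type} [MeasurableSpace β]
    (obs : Outcome d n → β) : ℝ :=
  ∫ ω, (target p ϕ d n ω
      - ((model p d n)[target p ϕ d n | MeasurableSpace.comap obs inferInstance]) ω) ^ 2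
    ∂(model p d n)

end PhaseSensing

end

/-!
The proof is a direct second moment computation. Let `Q` be the law of the data in which the
measurements are drawn from their marginal law `outLaw p`, independently of the sensing vectors. The
law of the data under the model is a mixture over the signal `X` of laws with density
`∏ i, lik p (Yᵢ, |⟨X, Aᵢ⟩|)` with respect to `Q`. Two signals with normalized squared inner product
`m` make `(⟨X, A⟩, ⟨X', A⟩)` a correlated Gaussian pair, so that one measurement contributes the
factor `f p m` and the likelihood ratio `Lₙ` satisfies
`E_Q Lₙ² = secondMoment p d n = E f(overlap X X')ⁿ`.

*The second moment stays bounded.* For `δ < deltaL p` there is `δ' > δ` with `F p δ' < 0` on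
`(0, 1]`, which means `f p m ≤ (1 - m) ^ (-1 / δ')`. The overlap of two independent uniform points
has `P(overlap > t) = (1 - t) ^ (d - 1)` (`signalLaw_overlap_gt`), hence
`E (1 - overlap) ^ (-s)` is at most `(d - 1) / (d - 1 - s)`, and this is bounded along `s = n / δ'`,
indeed along `s = (n + j) / δ'` for `j` up to a small multiple of `n`.

*Its increments vanish.* The increments of `n ↦ E f(overlap)ⁿ` are controlled by convexity:
`j (Sₙ₊₁ - Sₙ) ≤ Sₙ₊ⱼ`, by Bernoulli's inequality. With `j` of order `n` this gives
`Sₙ₊₁ - Sₙ → 0` (`exists_tendsto_secondMoment_increment`).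

*Vanishing increments hide the target.* Since `Lₙ` is a martingale under `Q`,
`Sₙ₊₁ - Sₙ = E_Q (Lₙ₊₁ - Lₙ)²`. Thus in total variation the data together with a further measurement
`Yₙ₊₁` look as if `Yₙ₊₁` were drawn from `outLaw p` independently of everything else. As
`Z = E(ϕ(Yₙ₊₁) | X, A)`, the target, centered at the mean of `ϕ` under `outLaw p`, is almost
uncorrelated with every bounded function of the data and of the new sensing vector
(`abs_integral_target_sub_mul_le`). Applied to the conditional expectation of `Z` itself this shows
that the variance of the latter vanishes, and by the law of total variance the mean square error
tends to the variance of `Z` (`mmse_mem_Icc`).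
-/

namespace PhaseSensing

/-! ### Gaussian vectors -/

instance isProbabilityMeasure_complexNormal (v : ℝ≥0) :
    IsProbabilityMeasure (complexNormal v) :=
  Measure.isProbabilityMeasure_map (by
    have : Measurable fun z : ℝ × ℝ => (⟨z.1, z.2⟩ : ℂ) :=
      Complex.measurableEquivRealProd.symm.measurable
    exact this.aemeasurable)

instance isProbabilityMeasure_complexNormalPair (c : ℂ) :
    IsProbabilityMeasure (complexNormalPair c) :=
  Measure.isProbabilityMeasure_map (by fun_prop)

instance isProbabilityMeasure_sensingLaw (d : ℕ) : IsProbabilityMeasure (sensingLaw d) :=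
  Measure.isProbabilityMeasure_map (by fun_prop)

lemma charFun_complexNormal (v : ℝ≥0) (t : ℂ) :
    charFun (complexNormal v) t = Complex.exp (-((v * ‖t‖ ^ 2 / 4 : ℝ) : ℂ)) := by
  have hm : Measurable fun z : ℝ × ℝ => (⟨z.1, z.2⟩ : ℂ) :=
    Complex.measurableEquivRealProd.symm.measurable
  have h1 := charFun_gaussianReal (μ := 0) (v := v / 2) t.re
  have h2 := charFun_gaussianReal (μ := 0) (v := v / 2) t.im
  rw [charFun_apply, complexNormal, integral_map hm.aemeasurable (by fun_prop)]
  rw [charFun_apply] at h1 h2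
  have : ∀ z : ℝ × ℝ, Complex.exp ((inner ℝ (⟨z.1, z.2⟩ : ℂ) t : ℝ) * Complex.I)
      = Complex.exp ((inner ℝ z.1 t.re : ℝ) * Complex.I)
        * Complex.exp ((inner ℝ z.2 t.im : ℝ) * Complex.I) := by
    intro z
    rw [← Complex.exp_add]
    congr 1
    simp [Complex.inner]
    ring
  simp_rw [this]
  rw [integral_prod_mul (fun z : ℝ => Complex.exp ((inner ℝ z t.re : ℝ) * Complex.I))
    (fun z : ℝ => Complex.exp ((inner ℝ z t.im : ℝ) * Complex.I)), h1, h2, ← Complex.exp_add]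
  congr 1
  rw [← Complex.normSq_eq_norm_sq, Complex.normSq_apply]
  push_cast
  ring

lemma charFun_sensingLaw (d : ℕ) (t : EuclideanSpace ℂ (Fin d)) :
    charFun (sensingLaw d) t = Complex.exp (-(((d : ℝ)⁻¹ * ‖t‖ ^ 2 / 4 : ℝ) : ℂ)) := by
  have h := charFun_pi (μ := fun _ : Fin d => complexNormal ((d : ℝ≥0)⁻¹)) t
  simp_rw [charFun_complexNormal] at h
  rw [sensingLaw]
  refine (Eq.trans ?_ h).trans ?_
  · rfl
  · rw [← Complex.exp_sum, EuclideanSpace.norm_sq_eq]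
    congr 1
    push_cast
    rw [Finset.sum_neg_distrib, Finset.mul_sum, Finset.sum_div]

lemma real_inner_euclideanSpace {d : ℕ} (a b : EuclideanSpace ℂ (Fin d)) :
    (inner ℝ a b : ℝ) = (inner ℂ a b : ℂ).re := by
  simp [PiLp.inner_apply, Complex.inner]

lemma exists_dual_prod_eq_inner (L : StrongDual ℝ (ℂ × ℂ)) :
    ∃ t₁ t₂ : ℂ, ∀ z : ℂ × ℂ, L z = (inner ℝ z.1 t₁ : ℝ) + (inner ℝ z.2 t₂ : ℝ) := by
  refine ⟨(InnerProductSpace.toDual ℝ ℂ).symm (L ∘SL ContinuousLinearMap.inl ℝ ℂ ℂ),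
    (InnerProductSpace.toDual ℝ ℂ).symm (L ∘SL ContinuousLinearMap.inr ℝ ℂ ℂ), fun z => ?_⟩
  rw [real_inner_comm, real_inner_comm _ z.2, InnerProductSpace.toDual_symm_apply,
    InnerProductSpace.toDual_symm_apply]
  simp only [ContinuousLinearMap.comp_apply, ContinuousLinearMap.inl_apply,
    ContinuousLinearMap.inr_apply, ← map_add]
  simp

/-- Two linear functionals of a sensing vector whose coefficient vectors have norm `√d` and a real
correlation `c` are jointly complex normal with correlation `c`: the characteristic functions of
the two laws agree. -/
lemma map_inner_pair_sensingLaw {d : ℕ} (hd : 0 < d) {x x' : EuclideanSpace ℂ (Fin d)}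
    (hx : ‖x‖ ^ 2 = d) (hx' : ‖x'‖ ^ 2 = d) {c : ℝ} (hc : c ^ 2 ≤ 1)
    (hxx' : inner ℂ x x' = ((d * c : ℝ) : ℂ)) :
    (sensingLaw d).map (fun a => (inner ℂ x a, inner ℂ x' a)) = complexNormalPair (c : ℂ) := by
  have hd' : (d : ℝ) ≠ 0 := by positivity
  have : IsProbabilityMeasure ((sensingLaw d).map
      (fun a => ((inner ℂ x a : ℂ), (inner ℂ x' a : ℂ)))) :=
    Measure.isProbabilityMeasure_map (by fun_prop)
  refine Measure.ext_of_charFunDual (funext fun L => ?_)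
  obtain ⟨t₁, t₂, hL⟩ := exists_dual_prod_eq_inner L
  set s : ℝ := Real.sqrt (1 - c ^ 2) with hs
  have hs2 : s ^ 2 = 1 - c ^ 2 := Real.sq_sqrt (by linarith)
  have h1 : charFunDual ((sensingLaw d).map (fun a => ((inner ℂ x a : ℂ), (inner ℂ x' a : ℂ)))) L
      = charFun (sensingLaw d) (t₁ • x + t₂ • x') := by
    rw [charFunDual_apply, integral_map (by fun_prop) (by fun_prop), charFun_apply]
    congr 1
    ext a
    congr 3
    rw [hL, real_inner_euclideanSpace, inner_add_right, inner_smul_right, inner_smul_right,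
      ← inner_conj_symm a x, ← inner_conj_symm a x']
    simp [Complex.inner]
  have h2 : charFunDual (complexNormalPair (c : ℂ)) L
      = charFun (complexNormal 1) (t₁ + c * t₂) * charFun (complexNormal 1) (s * t₂) := by
    rw [charFunDual_apply, complexNormalPair, integral_map (by fun_prop) (by fun_prop),
      charFun_apply, charFun_apply, ← integral_prod_mul]
    congr 1
    ext z
    rw [← Complex.exp_add, hL]
    congr 1
    rw [← add_mul, ← Complex.ofReal_add]
    congr 2
    simp [Complex.inner, ← hs]
    ring
  rw [h1, h2, charFun_sensingLaw, charFun_complexNormal, charFun_complexNormal, ← Complex.exp_add]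
  congr 1
  rw [← neg_add, ← Complex.ofReal_add]
  congr 2
  have h3 : ‖t₁ • x + t₂ • x'‖ ^ 2
      = d * (‖t₁‖ ^ 2 + ‖t₂‖ ^ 2 + 2 * c * ((starRingEnd ℂ) t₁ * t₂).re) := by
    rw [@norm_add_sq ℂ, norm_smul, norm_smul, mul_pow, mul_pow, hx, hx', inner_smul_left,
      inner_smul_right, hxx']
    simp
    ring
  have h4 : ‖t₁ + c * t₂‖ ^ 2
      = ‖t₁‖ ^ 2 + c ^ 2 * ‖t₂‖ ^ 2 + 2 * c * ((starRingEnd ℂ) t₁ * t₂).re := by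
    simp only [← Complex.normSq_eq_norm_sq, Complex.normSq_apply]
    simp
    ring
  rw [h3, h4, norm_mul, mul_pow, Complex.norm_real, Real.norm_eq_abs, sq_abs, hs2]
  field_simp
  push_cast
  ring

/-- The correlation parameter `|⟨x, x'⟩|² / d²` of two signals of norm `√d`. -/
noncomputable def overlap {d : ℕ} (x x' : EuclideanSpace ℂ (Fin d)) : ℝ :=
  ‖inner ℂ x x'‖ ^ 2 / (d : ℝ) ^ 2

lemma overlap_nonneg {d : ℕ} (x x' : EuclideanSpace ℂ (Fin d)) : 0 ≤ overlap x x' := by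
  unfold overlap; positivity

lemma overlap_le_one {d : ℕ} {x x' : EuclideanSpace ℂ (Fin d)}
    (hx : ‖x‖ ^ 2 = d) (hx' : ‖x'‖ ^ 2 = d) : overlap x x' ≤ 1 := by
  refine div_le_one_of_le₀ ?_ (by positivity)
  calc ‖inner ℂ x x'‖ ^ 2 ≤ (‖x‖ * ‖x'‖) ^ 2 := by gcongr; exact norm_inner_le_norm x x'
    _ = (d : ℝ) ^ 2 := by rw [mul_pow, hx, hx', sq]

lemma absInner_eq {d : ℕ} (x a : EuclideanSpace ℂ (Fin d)) : absInner x a = ‖inner ℂ x a‖₊ :=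
  NNReal.eq (norm_inner_symm a x)

@[fun_prop]
lemma measurable_absInner {d : ℕ} :
    Measurable (fun z : EuclideanSpace ℂ (Fin d) × EuclideanSpace ℂ (Fin d) =>
      absInner z.1 z.2) := by
  unfold absInner; fun_prop

/-- The moduli of the projections of a sensing vector on two signals depend on the signals only
through their overlap, since a phase shift of a signal changes neither. -/
lemma lintegral_absInner_pair {d : ℕ} (hd : 0 < d) {x x' : EuclideanSpace ℂ (Fin d)}
    (hx : ‖x‖ ^ 2 = d) (hx' : ‖x'‖ ^ 2 = d) {g : ℝ≥0 → ℝ≥0 → ℝ≥0∞}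
    (hg : Measurable (Function.uncurry g)) :
    ∫⁻ a, g (absInner x a) (absInner x' a) ∂(sensingLaw d)
      = ∫⁻ z, g ‖z.1‖₊ ‖z.2‖₊ ∂(complexNormalPair ((Real.sqrt (overlap x x') : ℝ) : ℂ)) := by
  have hd' : (d : ℝ) ≠ 0 := by positivity
  obtain ⟨u, hu, hux⟩ : ∃ u : ℂ, ‖u‖ = 1 ∧ u * inner ℂ x x' = (‖(inner ℂ x x' : ℂ)‖ : ℂ) := by
    by_cases h : (inner ℂ x x' : ℂ) = 0
    · exact ⟨1, by simp, by simp [h]⟩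
    · refine ⟨‖(inner ℂ x x' : ℂ)‖ / inner ℂ x x', ?_, ?_⟩
      · simp [h]
      · field_simp
  have hc : Real.sqrt (overlap x x') = ‖(inner ℂ x x' : ℂ)‖ / d := by
    rw [overlap, ← div_pow, Real.sqrt_sq (by positivity)]
  have hlaw := map_inner_pair_sensingLaw hd hx (x' := u • x')
    (by rw [norm_smul, hu, one_mul, hx']) (c := Real.sqrt (overlap x x'))
    (by rw [Real.sq_sqrt (overlap_nonneg _ _)]; exact overlap_le_one hx hx')
    (by rw [inner_smul_right, hux, hc]; rw [mul_div_cancel₀ _ hd'])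
  have hg' : Measurable fun z : ℂ × ℂ => g ‖z.1‖₊ ‖z.2‖₊ :=
    hg.comp (f := fun z : ℂ × ℂ => (‖z.1‖₊, ‖z.2‖₊)) (by fun_prop)
  rw [← hlaw, lintegral_map hg' (by fun_prop)]
  congr 1
  ext a
  have hn : ‖(inner ℂ (u • x') a : ℂ)‖₊ = ‖(inner ℂ x' a : ℂ)‖₊ := by
    rw [inner_smul_left, nnnorm_mul]
    have : ‖(starRingEnd ℂ) u‖₊ = 1 := NNReal.eq (by simpa using hu)
    rw [this, one_mul]
  simp only [hn, absInner_eq]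

lemma map_fst_complexNormalPair (c : ℂ) :
    (complexNormalPair c).map Prod.fst = complexNormal 1 := by
  rw [complexNormalPair, Measure.map_map measurable_fst (by fun_prop)]
  exact measurePreserving_fst.map_eq

@[fun_prop]
lemma measurable_absInner_right {d : ℕ} (x : EuclideanSpace ℂ (Fin d)) :
    Measurable (absInner x) := by
  unfold absInner; fun_prop

/-- The modulus of the projection of a sensing vector on a signal is that of a standard complex
normal variable. -/
lemma map_absInner_sensingLaw {d : ℕ} (hd : 0 < d) {x : EuclideanSpace ℂ (Fin d)}
    (hx : ‖x‖ ^ 2 = d) :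
    (sensingLaw d).map (absInner x) = (complexNormal 1).map (fun g => ‖g‖₊) := by
  have hm : Measurable (absInner x) := measurable_absInner_right x
  ext s hs
  have hi : Measurable (s.indicator (1 : ℝ≥0 → ℝ≥0∞)) := measurable_one.indicator hs
  have h := lintegral_absInner_pair hd hx hx (g := fun r _ => s.indicator 1 r)
    (hi.comp measurable_fst)
  have hj : Measurable fun z : ℂ => s.indicator (1 : ℝ≥0 → ℝ≥0∞) ‖z‖₊ :=
    hi.comp measurable_nnnorm
  rw [← lintegral_indicator_one hs, ← lintegral_indicator_one hs, lintegral_map hi hm,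
    lintegral_map hi (by fun_prop), h, ← map_fst_complexNormalPair, lintegral_map hj measurable_fst]

/-! ### The uniform law on the sphere -/

/-- Integration in polar coordinates of a function homogeneous of degree `0` against a radial
weight. -/
lemma lintegral_homogeneous_mul_radial {E : Type*} [NormedAddCommGroup E] [NormedSpace ℝ E]
    [FiniteDimensional ℝ E] [Nontrivial E] [MeasurableSpace E] [BorelSpace E] (μ : Measure E)
    [μ.IsAddHaarMeasure] {h : E → ℝ≥0∞} (hm : Measurable h)
    (hh : ∀ (r : ℝ) (z : E), 0 < r → h (r • z) = h z) {w : ℝ → ℝ≥0∞} (hw : Measurable w) :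
    ∫⁻ z, h z * w ‖z‖ ∂μ
      = (∫⁻ u, h (u : E) ∂μ.toSphere)
        * ∫⁻ r, w (r : ℝ) ∂(Measure.volumeIoiPow (Module.finrank ℝ E - 1)) := by
  have h1 : ∫⁻ z, h z * w ‖z‖ ∂μ
      = ∫⁻ z : ({0}ᶜ : Set E), h z * w ‖(z : E)‖ ∂(μ.comap Subtype.val) := by
    rw [lintegral_subtype_comap (measurableSet_singleton 0).compl (fun z => h z * w ‖z‖),
      Measure.restrict_eq_self_of_ae_mem]
    rw [ae_iff]; simp
  have h2 := μ.measurePreserving_homeomorphUnitSphereProd.lintegral_comp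
    (f := fun z => h (z.1 : E) * w (z.2 : ℝ)) (by fun_prop)
  rw [h1, ← lintegral_prod_mul (by fun_prop) (by fun_prop), ← h2]
  refine lintegral_congr fun z => ?_
  have hz : 0 < ‖(z : E)‖ := norm_pos_iff.2 z.2
  simp [hh _ _ (inv_pos.2 hz)]

instance isProbabilityMeasure_unitSphereUnif (d : ℕ) [NeZero d] :
    IsProbabilityMeasure (unitSphereUnif d) := by
  constructor
  rw [unitSphereUnif, Measure.smul_apply, smul_eq_mul, ENNReal.inv_mul_cancel]
  · exact (Measure.measure_univ_ne_zero).2 (Measure.toSphere_ne_zero _)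
  · exact measure_ne_top _ _

instance isProbabilityMeasure_signalLaw (d : ℕ) [NeZero d] :
    IsProbabilityMeasure (signalLaw d) :=
  Measure.isProbabilityMeasure_map (by fun_prop)

lemma ae_signalLaw_norm_sq (d : ℕ) : ∀ᵐ x ∂(signalLaw d), ‖x‖ ^ 2 = (d : ℝ) := by
  refine (ae_map_iff (by fun_prop) (by
    exact measurableSet_eq_fun (by fun_prop) (by fun_prop))).2 (ae_of_all _ fun u => ?_)
  rw [norm_smul, norm_eq_of_mem_sphere u]
  simp

/-- The Gaussian weight `exp (-r²)`. -/
noncomputable def gaussWeight (r : ℝ) : ℝ≥0∞ := ENNReal.ofReal (Real.exp (-r ^ 2))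

@[fun_prop]
lemma measurable_gaussWeight : Measurable gaussWeight := by
  unfold gaussWeight; fun_prop

lemma integral_exp_neg_sq_tail {a : ℝ} (ha : 0 ≤ a) :
    IntegrableOn (fun y : ℝ => y * Real.exp (-y ^ 2)) (Set.Ioi a)
      ∧ ∫ y in Set.Ioi a, y * Real.exp (-y ^ 2) = Real.exp (-a ^ 2) / 2 := by
  have hd : ∀ x ∈ Set.Ioi a, HasDerivAt (fun y : ℝ => -(Real.exp (-y ^ 2) / 2))
      (x * Real.exp (-x ^ 2)) x := by
    intro x _
    have h : HasDerivAt (fun y : ℝ => -(Real.exp (-y ^ 2) / 2))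
        (-(Real.exp (-x ^ 2) * (-(2 * x)) / 2)) x := by
      simpa using (((hasDerivAt_pow 2 x).fun_neg).exp.div_const 2).fun_neg
    exact h.congr_deriv (by ring)
  have hc : ContinuousWithinAt (fun y : ℝ => -(Real.exp (-y ^ 2) / 2)) (Set.Ici a) a := by
    fun_prop
  have hn : ∀ x ∈ Set.Ioi a, 0 ≤ x * Real.exp (-x ^ 2) := fun x hx =>
    mul_nonneg (ha.trans (le_of_lt hx)) (Real.exp_pos _).le
  have ht : Tendsto (fun y : ℝ => -(Real.exp (-y ^ 2) / 2)) atTop (𝓝 0) := by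
    have h1 : Tendsto (fun y : ℝ => Real.exp (-y ^ 2)) atTop (𝓝 0) :=
      Real.tendsto_exp_neg_atTop_nhds_zero.comp (tendsto_pow_atTop (by norm_num))
    simpa using (h1.div_const 2).neg
  refine ⟨integrableOn_Ioi_deriv_of_nonneg hc hd hn ht, ?_⟩
  rw [integral_Ioi_of_hasDerivAt_of_nonneg hc hd hn ht]
  ring

/-- The squared modulus of a standard complex normal variable is exponentially distributed. -/
lemma lintegral_indicator_mul_gaussWeight {ρ : ℝ} (hρ : 0 ≤ ρ) :
    ∫⁻ z : ℂ, {z : ℂ | ρ < ‖z‖ ^ 2}.indicator 1 z * gaussWeight ‖z‖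
      = ENNReal.ofReal (Real.pi * Real.exp (-ρ)) := by
  set F : ℝ → ℝ := fun r => {r : ℝ | ρ < r ^ 2}.indicator (fun r => Real.exp (-r ^ 2)) r with hF
  have hset : ∀ y ∈ Set.Ioi (0 : ℝ), y ^ (Module.finrank ℝ ℂ - 1) • F y
      = (Set.Ioi (Real.sqrt ρ)).indicator (fun y => y * Real.exp (-y ^ 2)) y := by
    intro y hy
    have : y ∈ {r : ℝ | ρ < r ^ 2} ↔ y ∈ Set.Ioi (Real.sqrt ρ) :=
      (Real.sqrt_lt' hy).symm
    by_cases h : y ∈ Set.Ioi (Real.sqrt ρ)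
    · simp only [hF, Set.indicator_of_mem h, Set.indicator_of_mem (this.2 h)]
      simp
    · simp only [hF, Set.indicator_of_notMem h, Set.indicator_of_notMem (fun h' => h (this.1 h'))]
      simp
  obtain ⟨hi, hv⟩ := integral_exp_neg_sq_tail (Real.sqrt_nonneg ρ)
  rw [Real.sq_sqrt hρ] at hv
  have hint : Integrable (fun z : ℂ => F ‖z‖) := by
    rw [integrable_fun_norm_addHaar]
    refine IntegrableOn.congr_fun ?_ (fun y hy => (hset y hy).symm) measurableSet_Ioi
    exact (hi.integrable_indicator measurableSet_Ioi).integrableOn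
  have hval : ∫ z : ℂ, F ‖z‖ = Real.pi * Real.exp (-ρ) := by
    rw [integral_fun_norm_addHaar, setIntegral_congr_fun measurableSet_Ioi hset,
      setIntegral_indicator measurableSet_Ioi, Set.Ioi_inter_Ioi,
      max_eq_right (Real.sqrt_nonneg ρ), hv]
    simp [Measure.real]
    ring
  rw [← hval, ofReal_integral_eq_lintegral_ofReal hint]
  · refine lintegral_congr fun z => ?_
    by_cases h : ρ < ‖z‖ ^ 2
    · simp [hF, Set.indicator, h, gaussWeight]
    · simp [hF, Set.indicator, h]
  · exact ae_of_all _ fun z => Set.indicator_nonneg (fun _ _ => (Real.exp_pos _).le) _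

lemma lintegral_exp_neg_mul_norm_sq {b : ℝ} (hb : 0 < b) :
    ∫⁻ z : ℂ, ENNReal.ofReal (Real.exp (-b * ‖z‖ ^ 2)) = ENNReal.ofReal (Real.pi / b) := by
  have h := GaussianFourier.integral_rexp_neg_mul_sq_norm (V := ℂ) hb
  rw [← ofReal_integral_eq_lintegral_ofReal, h]
  · simp
  · refine Integrable.of_integral_ne_zero ?_
    rw [h]; positivity
  · exact ae_of_all _ fun _ => (Real.exp_pos _).le

/-- Fubini's theorem for a product of functions of the separate coordinates. -/
lemma lintegral_pi_fin_prod {B : Type*} [MeasurableSpace B] (β : Measure B) [SigmaFinite β]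
    {n : ℕ} {f : Fin n → B → ℝ≥0∞} (hf : ∀ i, Measurable (f i)) :
    ∫⁻ b, ∏ i, f i (b i) ∂(Measure.pi fun _ : Fin n => β) = ∏ i, ∫⁻ b, f i b ∂β := by
  induction n with
  | zero => simp
  | succ n ih =>
    have h := (measurePreserving_piFinSuccAbove (fun _ : Fin (n + 1) => β) 0).symm
    rw [← h.lintegral_comp_emb (MeasurableEquiv.measurableEmbedding _)]
    simp only [Fin.prod_univ_succ, MeasurableEquiv.piFinSuccAbove_symm_apply,
      Fin.insertNthEquiv_zero, Fin.consEquiv_apply, Fin.cons_zero, Fin.cons_succ]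
    rw [lintegral_prod_mul (g := fun b : Fin n → B => ∏ i, f i.succ (b i)) (hf 0).aemeasurable
      (Finset.measurable_prod _ fun i _ => (hf i.succ).comp (measurable_pi_apply i)).aemeasurable,
      ih fun i => hf i.succ]

/-- The Gaussian measure of the cone on which the first coordinate carries more than a fraction `t`
of the squared norm. -/
lemma lintegral_pi_cone {t : ℝ} (ht : 0 ≤ t) (ht1 : t < 1) (k : ℕ) :
    ∫⁻ w : Fin (k + 1) → ℂ, {w : Fin (k + 1) → ℂ | t * ∑ i, ‖w i‖ ^ 2 < ‖w 0‖ ^ 2}.indicator 1 w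
        * ∏ i, gaussWeight ‖w i‖
      = ENNReal.ofReal (Real.pi ^ (k + 1) * (1 - t) ^ k) := by
  have h1t : 0 < 1 - t := by linarith
  have h := (volume_preserving_piFinSuccAbove (fun _ : Fin (k + 1) => ℂ) 0).symm
  rw [← h.lintegral_comp_emb (MeasurableEquiv.measurableEmbedding _)]
  have key : ∀ z : ℂ × (Fin k → ℂ),
      {w : Fin (k + 1) → ℂ | t * ∑ i, ‖w i‖ ^ 2 < ‖w 0‖ ^ 2}.indicator
          (1 : (Fin (k + 1) → ℂ) → ℝ≥0∞)
          ((MeasurableEquiv.piFinSuccAbove (fun _ : Fin (k + 1) => ℂ) 0).symm z)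
        * ∏ i, gaussWeight ‖(MeasurableEquiv.piFinSuccAbove (fun _ : Fin (k + 1) => ℂ) 0).symm z i‖
      = ({z' : ℂ | t / (1 - t) * ∑ i, ‖z.2 i‖ ^ 2 < ‖z'‖ ^ 2}.indicator 1 z.1
          * gaussWeight ‖z.1‖) * ∏ i, gaussWeight ‖z.2 i‖ := by
    intro z
    simp only [Fin.prod_univ_succ, Fin.sum_univ_succ, MeasurableEquiv.piFinSuccAbove_symm_apply,
      Fin.insertNthEquiv_zero, Fin.consEquiv_apply, Fin.cons_zero, Fin.cons_succ, Set.indicator,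
      Set.mem_ofPred_eq, mul_assoc]
    congr 1
    refine if_congr ?_ rfl rfl
    rw [div_mul_eq_mul_div, div_lt_iff₀ h1t]
    constructor <;> intro h <;> nlinarith
  simp_rw [key]
  rw [Measure.volume_eq_prod, lintegral_prod_symm]
  swap
  · refine (Measurable.mul (Measurable.mul ?_ (by fun_prop)) (by fun_prop)).aemeasurable
    exact measurable_one.indicator (s := {z : ℂ × (Fin k → ℂ) |
      t / (1 - t) * ∑ i, ‖z.2 i‖ ^ 2 < ‖z.1‖ ^ 2}) (measurableSet_lt (by fun_prop) (by fun_prop))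
  have inner : ∀ w : Fin k → ℂ,
      ∫⁻ z : ℂ, ({z' : ℂ | t / (1 - t) * ∑ i, ‖w i‖ ^ 2 < ‖z'‖ ^ 2}.indicator 1 z
          * gaussWeight ‖z‖) * ∏ i, gaussWeight ‖w i‖
      = ENNReal.ofReal Real.pi * ∏ i, ENNReal.ofReal (Real.exp (-(1 - t)⁻¹ * ‖w i‖ ^ 2)) := by
    intro w
    rw [lintegral_mul_const'' _ (Measurable.aemeasurable (by
      refine Measurable.mul (measurable_one.indicator ?_) (by fun_prop)
      exact measurableSet_lt (by fun_prop) (by fun_prop))),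
      lintegral_indicator_mul_gaussWeight (by positivity), ENNReal.ofReal_mul Real.pi_pos.le,
      mul_assoc]
    congr 1
    simp only [gaussWeight]
    rw [← ENNReal.ofReal_prod_of_nonneg (fun _ _ => (Real.exp_pos _).le),
      ← ENNReal.ofReal_prod_of_nonneg (fun _ _ => (Real.exp_pos _).le),
      ← ENNReal.ofReal_mul (Real.exp_pos _).le, ← Real.exp_sum, ← Real.exp_sum, ← Real.exp_add]
    congr 2
    rw [Finset.mul_sum, ← Finset.sum_neg_distrib, ← Finset.sum_add_distrib]
    refine Finset.sum_congr rfl fun i _ => ?_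
    field_simp
    ring
  simp_rw [inner]
  rw [lintegral_const_mul _ (by fun_prop), volume_pi, lintegral_pi_fin_prod _
      (f := fun _ z => ENNReal.ofReal (Real.exp (-(1 - t)⁻¹ * ‖z‖ ^ 2))) (fun _ => by fun_prop),
    Finset.prod_const, lintegral_exp_neg_mul_norm_sq (inv_pos.2 h1t), Finset.card_univ,
    Fintype.card_fin, ← ENNReal.ofReal_pow (by positivity), ← ENNReal.ofReal_mul Real.pi_pos.le]
  congr 1
  rw [div_inv_eq_mul, mul_pow]
  ring

lemma exists_lintegral_euclideanSpace_eq (d : ℕ) :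
    ∃ c : ℝ≥0, c ≠ 0 ∧ ∀ F : EuclideanSpace ℂ (Fin d) → ℝ≥0∞, Measurable F →
      ∫⁻ z, F z = c * ∫⁻ w : Fin d → ℂ, F (WithLp.toLp 2 w) := by
  set e := (PiLp.continuousLinearEquiv 2 ℝ (fun _ : Fin d => ℂ)).symm
  have he : ∀ w, e w = WithLp.toLp 2 w := fun _ => rfl
  have hH : (Measure.map e (volume : Measure (Fin d → ℂ))).IsAddHaarMeasure :=
    e.isAddHaarMeasure_map _
  have h := Measure.isAddLeftInvariant_eq_smul (volume : Measure (EuclideanSpace ℂ (Fin d)))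
    (Measure.map e (volume : Measure (Fin d → ℂ)))
  set c := (volume : Measure (EuclideanSpace ℂ (Fin d))).addHaarScalarFactor
    (Measure.map e (volume : Measure (Fin d → ℂ)))
  refine ⟨c, fun h0 => ?_, fun F hF => ?_⟩
  · rw [h0, zero_smul] at h
    exact NeZero.ne (volume : Measure (EuclideanSpace ℂ (Fin d))) h
  · rw [h, lintegral_smul_measure, lintegral_map hF e.continuous.measurable]
    rfl

/-- The overlap of a fixed signal with a uniform one has the `Beta(1, d - 1)` law. In polar
coordinates, the uniform measure of the cone `{z | t ‖z‖² < |⟨e, z⟩|²}`, `e = x / ‖x‖`, is its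
Gaussian measure, and the latter is computed in an orthonormal basis that contains `e`. -/
lemma signalLaw_overlap_gt {d k : ℕ} (hd : d = k + 1) {x : EuclideanSpace ℂ (Fin d)}
    (hx : ‖x‖ ^ 2 = (d : ℝ)) {t : ℝ} (ht : 0 ≤ t) (ht1 : t < 1) :
    signalLaw d {x' | t < overlap x x'} = ENNReal.ofReal ((1 - t) ^ k) := by
  have : NeZero d := ⟨by omega⟩
  have hpc : ∫⁻ w : Fin d → ℂ, {w : Fin d → ℂ | t * ∑ i, ‖w i‖ ^ 2 < ‖w 0‖ ^ 2}.indicator 1 w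
      * ∏ i, gaussWeight ‖w i‖ = ENNReal.ofReal (Real.pi ^ (k + 1) * (1 - t) ^ k) := by
    subst hd
    exact lintegral_pi_cone ht ht1 k
  have hd0 : (0 : ℝ) < d := Nat.cast_pos.2 (NeZero.pos d)
  set e : EuclideanSpace ℂ (Fin d) := ((Real.sqrt d : ℝ) : ℂ)⁻¹ • x with he
  have hx1 : ‖x‖ = Real.sqrt d := by rw [← hx, Real.sqrt_sq (norm_nonneg _)]
  have hsd : 0 < Real.sqrt d := Real.sqrt_pos.2 hd0
  have he1 : ‖e‖ = 1 := by
    rw [he, norm_smul, norm_inv, Complex.norm_real, hx1, Real.norm_of_nonneg hsd.le,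
      inv_mul_cancel₀ hsd.ne']
  -- the cone cut out by the overlap, as a homogeneous function
  set C : Set (EuclideanSpace ℂ (Fin d)) := {z | t * ‖z‖ ^ 2 < ‖(inner ℂ e z : ℂ)‖ ^ 2} with hC
  have hCm : MeasurableSet C := measurableSet_lt (by fun_prop) (by fun_prop)
  have hCh : ∀ (r : ℝ) (z : EuclideanSpace ℂ (Fin d)), 0 < r →
      C.indicator (1 : EuclideanSpace ℂ (Fin d) → ℝ≥0∞) (r • z) = C.indicator 1 z := by
    intro r z hr
    have : r • z ∈ C ↔ z ∈ C := by
      have h1 : (inner ℂ e (r • z) : ℂ) = (r : ℂ) * inner ℂ e z := by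
        rw [← inner_smul_right]; rfl
      simp only [hC, Set.mem_ofPred_eq, h1, norm_smul, norm_mul, Complex.norm_real, mul_pow]
      have : 0 < ‖r‖ ^ 2 := by have := norm_pos_iff.2 hr.ne'; positivity
      constructor <;> intro h <;> nlinarith
    by_cases h : z ∈ C
    · rw [Set.indicator_of_mem h, Set.indicator_of_mem (this.2 h)]; rfl
    · rw [Set.indicator_of_notMem h, Set.indicator_of_notMem (fun h' => h (this.1 h'))]
  set T := (volume : Measure (EuclideanSpace ℂ (Fin d))).toSphere
  have hT0 : T Set.univ ≠ 0 := (Measure.measure_univ_ne_zero).2 (Measure.toSphere_ne_zero _)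
  have hTt : T Set.univ ≠ ∞ := measure_ne_top _ _
  have h1 : signalLaw d {x' | t < overlap x x'}
      = (T Set.univ)⁻¹ * ∫⁻ u, C.indicator 1 (u : EuclideanSpace ℂ (Fin d)) ∂T := by
    have hm : MeasurableSet {x' : EuclideanSpace ℂ (Fin d) | t < overlap x x'} :=
      measurableSet_lt (by fun_prop) (by unfold overlap; fun_prop)
    rw [signalLaw, ← lintegral_indicator_one hm, lintegral_map
      (measurable_one.indicator hm) (by fun_prop), unitSphereUnif, lintegral_smul_measure,
      smul_eq_mul]
    congr 1
    refine lintegral_congr fun u => ?_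
    have hu : ‖(u : EuclideanSpace ℂ (Fin d))‖ = 1 := norm_eq_of_mem_sphere u
    simp only [Set.indicator, hC, Set.mem_ofPred_eq]
    refine if_congr ?_ rfl rfl
    rw [overlap, inner_smul_right, he, inner_smul_left, hu]
    simp only [norm_mul, map_inv₀, Complex.conj_ofReal, norm_inv, Complex.norm_real, mul_pow,
      inv_pow, Real.norm_of_nonneg hsd.le, Real.sq_sqrt hd0.le]
    have : (d : ℝ) * ‖(inner ℂ x (u : EuclideanSpace ℂ (Fin d)) : ℂ)‖ ^ 2 / (d : ℝ) ^ 2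
        = (d : ℝ)⁻¹ * ‖(inner ℂ x (u : EuclideanSpace ℂ (Fin d)) : ℂ)‖ ^ 2 := by
      field_simp
    rw [this]
    simp
  -- Gaussian integrals over the cone and over the whole space
  have hon : Orthonormal ℂ (({0} : Set (Fin d)).domRestrict (fun _ => e)) :=
    ⟨fun _ => he1, fun i j hij => absurd (Subsingleton.elim i j) hij⟩
  obtain ⟨b, hb⟩ := hon.exists_orthonormalBasis_extension_of_card_eq (by simp)
  obtain ⟨c, hc0, hc⟩ := exists_lintegral_euclideanSpace_eq d
  have hmp : MeasurePreserving (b.repr : EuclideanSpace ℂ (Fin d) → EuclideanSpace ℂ (Fin d))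
      volume volume := by
    let f : EuclideanSpace ℂ (Fin d) ≃ₗᵢ[ℝ] EuclideanSpace ℂ (Fin d) :=
      { b.repr.toLinearEquiv.restrictScalars ℝ with norm_map' := b.repr.norm_map }
    exact f.measurePreserving
  have hnorm : ∀ w : Fin d → ℂ, gaussWeight ‖WithLp.toLp 2 w‖ = ∏ i, gaussWeight ‖w i‖ := by
    intro w
    simp only [gaussWeight]
    rw [← ENNReal.ofReal_prod_of_nonneg (fun _ _ => (Real.exp_pos _).le), ← Real.exp_sum,
      EuclideanSpace.norm_sq_eq, Finset.sum_neg_distrib]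
  have hcone : ∫⁻ z, C.indicator 1 z * gaussWeight ‖z‖
      = c * ENNReal.ofReal (Real.pi ^ (k + 1) * (1 - t) ^ k) := by
    set D : Set (EuclideanSpace ℂ (Fin d)) := {z | t * ‖z‖ ^ 2 < ‖z 0‖ ^ 2} with hD
    have hDm : MeasurableSet D := measurableSet_lt (by fun_prop) (by fun_prop)
    have h2 : ∀ z, C.indicator 1 z * gaussWeight ‖z‖
        = D.indicator 1 (b.repr z) * gaussWeight ‖b.repr z‖ := by
      intro z
      have : z ∈ C ↔ b.repr z ∈ D := by
        simp only [hC, hD, Set.mem_ofPred_eq, b.repr.norm_map, b.repr_apply_apply,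
          hb 0 (Set.mem_singleton 0)]
      rw [b.repr.norm_map]
      by_cases h : z ∈ C
      · rw [Set.indicator_of_mem h, Set.indicator_of_mem (this.1 h)]; rfl
      · rw [Set.indicator_of_notMem h, Set.indicator_of_notMem (fun h' => h (this.2 h'))]
    have hDm' : Measurable fun z =>
        D.indicator (1 : EuclideanSpace ℂ (Fin d) → ℝ≥0∞) z * gaussWeight ‖z‖ :=
      (measurable_one.indicator hDm).mul (by fun_prop)
    rw [lintegral_congr h2, hmp.lintegral_comp hDm', hc _ hDm', ← hpc]
    congr 1
    refine lintegral_congr fun w => ?_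
    rw [hnorm]
    congr 1
    simp only [Set.indicator, hD, Set.mem_ofPred_eq, EuclideanSpace.norm_sq_eq]
    rfl
  have htot : ∫⁻ z : EuclideanSpace ℂ (Fin d), gaussWeight ‖z‖
      = c * ENNReal.ofReal (Real.pi ^ (k + 1)) := by
    rw [hc _ (by fun_prop)]
    simp_rw [hnorm]
    have hone : ∫⁻ z : ℂ, gaussWeight ‖z‖ = ENNReal.ofReal Real.pi := by
      simpa [gaussWeight] using lintegral_exp_neg_mul_norm_sq one_pos
    rw [volume_pi, lintegral_pi_fin_prod _ (f := fun _ z => gaussWeight ‖z‖)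
      (fun _ => by fun_prop), hone, Finset.prod_const, Finset.card_univ, Fintype.card_fin,
      ← hd, ENNReal.ofReal_pow Real.pi_pos.le]
  have hp1 := lintegral_homogeneous_mul_radial (volume : Measure (EuclideanSpace ℂ (Fin d)))
    (measurable_one.indicator hCm) hCh measurable_gaussWeight
  have hp2 := lintegral_homogeneous_mul_radial (volume : Measure (EuclideanSpace ℂ (Fin d)))
    (h := fun _ => 1) measurable_const (fun _ _ _ => rfl) measurable_gaussWeight
  simp only [one_mul, lintegral_const] at hp2
  rw [htot] at hp2
  rw [hcone] at hp1
  set R := ∫⁻ r, gaussWeight (r : ℝ)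
    ∂(Measure.volumeIoiPow (Module.finrank ℝ (EuclideanSpace ℂ (Fin d)) - 1))
  have hpi : ENNReal.ofReal (Real.pi ^ (k + 1)) ≠ 0 := by
    simp only [ne_eq, ENNReal.ofReal_eq_zero, not_le]; positivity
  have hne : T Set.univ * R ≠ 0 := by
    rw [← hp2]; exact mul_ne_zero (by exact_mod_cast hc0) hpi
  have hnt : T Set.univ * R ≠ ∞ := by
    rw [← hp2]; exact ENNReal.mul_ne_top (by simp) (by simp)
  have hR0 : R ≠ 0 := fun h => hne (by rw [h, mul_zero])
  have hRt : R ≠ ∞ := fun h => hnt (by rw [h, ENNReal.mul_top hT0])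
  rw [ENNReal.ofReal_mul (by positivity), ← mul_assoc, hp2, mul_right_comm] at hp1
  rw [h1, ← (ENNReal.mul_left_inj hR0 hRt).1 hp1, ← mul_assoc, ENNReal.inv_mul_cancel hT0 hTt,
    one_mul]

@[fun_prop]
lemma measurable_overlap_right {d : ℕ} (x : EuclideanSpace ℂ (Fin d)) :
    Measurable (overlap x) := by
  unfold overlap; fun_prop

lemma ae_overlap_mem_Ioo {d k : ℕ} (hd : d = k + 1) (hk : k ≠ 0) {x : EuclideanSpace ℂ (Fin d)}
    (hx : ‖x‖ ^ 2 = (d : ℝ)) : ∀ᵐ x' ∂(signalLaw d), overlap x x' ∈ Set.Ioo (0 : ℝ) 1 := by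
  have : NeZero d := ⟨by omega⟩
  have h0 : ∀ᵐ x' ∂(signalLaw d), 0 < overlap x x' :=
    (mem_ae_iff_prob_eq_one (measurableSet_lt (by fun_prop) (by fun_prop))).2
      ((signalLaw_overlap_gt hd hx le_rfl one_pos).trans (by simp))
  have h1 : ∀ᵐ x' ∂(signalLaw d), overlap x x' < 1 := by
    rw [ae_iff]
    refine le_antisymm (ge_of_tendsto (x := 𝓝[<] (1 : ℝ))
      (f := fun t => ENNReal.ofReal ((1 - t) ^ k)) ?_ ?_) zero_le
    · have : Tendsto (fun t : ℝ => ENNReal.ofReal ((1 - t) ^ k)) (𝓝 1)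
          (𝓝 (ENNReal.ofReal ((1 - 1) ^ k))) := by
        refine ENNReal.tendsto_ofReal (Continuous.tendsto ?_ 1)
        fun_prop
      rw [sub_self, zero_pow hk, ENNReal.ofReal_zero] at this
      exact this.mono_left nhdsWithin_le_nhds
    · filter_upwards [Ioo_mem_nhdsLT (zero_lt_one (α := ℝ))] with t ht
      rw [← signalLaw_overlap_gt hd hx ht.1.le ht.2]
      exact measure_mono fun x' hx' => ht.2.trans_le (not_lt.1 hx')
  filter_upwards [h0, h1] with x' h0 h1 using ⟨h0, h1⟩

/-- Negative moments of `1 - m`, `m` the overlap with a uniform signal; they are finite up to the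
order `d - 1`. -/
lemma lintegral_one_sub_overlap_rpow_le {d k : ℕ} (hd : d = k + 1)
    {x : EuclideanSpace ℂ (Fin d)} (hx : ‖x‖ ^ 2 = (d : ℝ)) {s : ℝ} (hs : 0 < s) (hsk : s < k) :
    ∫⁻ x', ENNReal.ofReal ((1 - overlap x x') ^ (-s)) ∂(signalLaw d)
      ≤ ENNReal.ofReal (k / (k - s)) := by
  have : NeZero d := ⟨by omega⟩
  have hnn : ∀ᵐ x' ∂(signalLaw d), 0 ≤ (1 - overlap x x') ^ (-s) := by
    filter_upwards [ae_signalLaw_norm_sq d] with x' hx'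
    exact Real.rpow_nonneg (by linarith [overlap_le_one hx hx']) _
  rw [lintegral_eq_lintegral_meas_lt _ hnn (by fun_prop),
    ← Set.Ioc_union_Ioi_eq_Ioi (zero_le_one (α := ℝ)),
    lintegral_union measurableSet_Ioi (by
      rw [Set.disjoint_left]; intro a h1 h2; exact not_lt.2 h1.2 h2)]
  have hlow : ∫⁻ u in Set.Ioc (0 : ℝ) 1,
      signalLaw d {x' | u < (1 - overlap x x') ^ (-s)} ≤ 1 := by
    calc _ ≤ ∫⁻ u in Set.Ioc (0 : ℝ) 1, 1 := lintegral_mono fun u => prob_le_one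
      _ = 1 := by simp
  have hexp : -(k / s) < -1 := by
    have := (one_lt_div hs).2 hsk
    linarith
  have hhigh : ∫⁻ u in Set.Ioi (1 : ℝ), signalLaw d {x' | u < (1 - overlap x x') ^ (-s)}
      ≤ ENNReal.ofReal (1 / (k / s - 1)) := by
    have h2 : ∫ u in Set.Ioi (1 : ℝ), u ^ (-((k : ℝ) / s)) = 1 / (k / s - 1) := by
      rw [integral_Ioi_rpow_of_lt hexp one_pos, Real.one_rpow, ← neg_div_neg_eq]
      congr 1 <;> ring
    rw [← h2, ofReal_integral_eq_lintegral_ofReal (integrableOn_Ioi_rpow_of_lt hexp one_pos)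
      ((ae_restrict_iff' measurableSet_Ioi).2 (ae_of_all _ fun u hu =>
        Real.rpow_nonneg (zero_le_one.trans (le_of_lt hu)) _))]
    refine setLIntegral_mono (by fun_prop) fun u hu => ?_
    have hu0 : (0 : ℝ) < u := one_pos.trans hu
    set t : ℝ := 1 - u ^ (-(1 / s)) with ht
    have hpow1 : u ^ (-(1 / s)) < 1 := Real.rpow_lt_one_of_one_lt_of_neg hu (by
      rw [neg_lt_zero]; positivity)
    have hpow0 : 0 < u ^ (-(1 / s)) := Real.rpow_pos_of_pos hu0 _
    have heq : u ^ (-((k : ℝ) / s)) = (1 - t) ^ k := by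
      rw [ht, sub_sub_cancel, ← Real.rpow_natCast, ← Real.rpow_mul hu0.le]
      congr 1; ring
    rw [heq, ← signalLaw_overlap_gt hd hx (t := t) (by linarith) (by linarith)]
    refine measure_mono_ae ?_
    filter_upwards [ae_signalLaw_norm_sq d] with x' hx' (h : u < (1 - overlap x x') ^ (-s))
    have hle : 0 ≤ 1 - overlap x x' := by linarith [overlap_le_one hx hx']
    have hlt : 0 < 1 - overlap x x' := by
      refine hle.lt_of_ne' fun h0 => ?_
      rw [h0, Real.zero_rpow (by linarith)] at h
      linarith
    have h3 : ((1 - overlap x x') ^ (-s)) ^ (-(1 / s)) < u ^ (-(1 / s)) :=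
      Real.rpow_lt_rpow_of_neg hu0 h (by rw [neg_lt_zero]; positivity)
    rw [← Real.rpow_mul hle, neg_mul_neg, mul_one_div_cancel hs.ne', Real.rpow_one] at h3
    change t < overlap x x'
    linarith
  refine (add_le_add hlow hhigh).trans ?_
  have hks : 0 < (k : ℝ) / s - 1 := by linarith
  rw [← ENNReal.ofReal_one, ← ENNReal.ofReal_add zero_le_one (by positivity)]
  refine ENNReal.ofReal_le_ofReal (le_of_eq ?_)
  have : (k : ℝ) - s ≠ 0 := by linarith
  field_simp
  ring

/-! ### The likelihood ratio of one observation -/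

/-- The marginal density `q(y) = E p(y ∣ |G|)` of a measurement. -/
noncomputable def outDensity (p : ℝ≥0 → ℝ → ℝ≥0) (y : ℝ) : ℝ≥0∞ :=
  ∫⁻ g, (p ‖g‖₊ y : ℝ≥0∞) ∂(complexNormal 1)

/-- The marginal law of a measurement. -/
noncomputable def outLaw (p : ℝ≥0 → ℝ → ℝ≥0) : Measure ℝ :=
  volume.withDensity (outDensity p)

/-- The likelihood ratio `p(y ∣ |⟨x, a⟩|) / q(y)` of the signal `x` for the observation
`b = (a, y)`, relative to a measurement independent of the sensing vector. -/
noncomputable def lik (p : ℝ≥0 → ℝ → ℝ≥0) {d : ℕ} (x : EuclideanSpace ℂ (Fin d))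
    (b : EuclideanSpace ℂ (Fin d) × ℝ) : ℝ≥0∞ :=
  p (absInner x b.1) b.2 / outDensity p b.2

namespace IsChannel

variable {p : ℝ≥0 → ℝ → ℝ≥0} (hp : IsChannel p)
include hp

lemma measurable_coe : Measurable (Function.uncurry fun r y => (p r y : ℝ≥0∞)) :=
  measurable_coe_nnreal_ennreal.comp hp.measurable

lemma measurable_outDensity : Measurable (outDensity p) :=
  Measurable.lintegral_prod_right' (f := fun z : ℝ × ℂ => (p ‖z.2‖₊ z.1 : ℝ≥0∞))
    (hp.measurable_coe.comp (f := fun z : ℝ × ℂ => (‖z.2‖₊, z.1)) (by fun_prop))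

lemma lintegral_outDensity : ∫⁻ y, outDensity p y = 1 := by
  unfold outDensity
  rw [lintegral_lintegral_swap]
  · simp [hp.lintegral_eq_one]
  · exact (hp.measurable_coe.comp (f := fun z : ℝ × ℂ => (‖z.2‖₊, z.1))
      (by fun_prop)).aemeasurable

lemma isProbabilityMeasure_outLaw : IsProbabilityMeasure (outLaw p) :=
  ⟨by rw [outLaw, withDensity_apply _ MeasurableSet.univ, Measure.restrict_univ,
    hp.lintegral_outDensity]⟩

lemma ae_outDensity_ne_top : ∀ᵐ y, outDensity p y ≠ ∞ :=
  (ae_lt_top hp.measurable_outDensity (by simp [hp.lintegral_outDensity])).mono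
    fun _ h => h.ne

lemma measurable_density {d : ℕ} : Measurable
    (fun z : EuclideanSpace ℂ (Fin d) × EuclideanSpace ℂ (Fin d) × ℝ =>
      (p (absInner z.1 z.2.1) z.2.2 : ℝ≥0∞)) :=
  hp.measurable_coe.comp
    (f := fun z : EuclideanSpace ℂ (Fin d) × EuclideanSpace ℂ (Fin d) × ℝ =>
      (absInner z.1 z.2.1, z.2.2)) (by unfold absInner; fun_prop)

lemma measurable_density_right {d : ℕ} (x : EuclideanSpace ℂ (Fin d)) (y : ℝ) :
    Measurable (fun a => (p (absInner x a) y : ℝ≥0∞)) :=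
  hp.measurable_density.comp (f := fun a => (x, a, y)) (by fun_prop)

lemma measurable_lik {d : ℕ} : Measurable (Function.uncurry (lik p (d := d))) :=
  hp.measurable_density.div (hp.measurable_outDensity.comp (by fun_prop))

lemma measurable_lik_right {d : ℕ} (x : EuclideanSpace ℂ (Fin d)) : Measurable (lik p x) :=
  hp.measurable_lik.comp (g := Function.uncurry (lik p)) (f := fun b => (x, b))
    measurable_prodMk_left

lemma lintegral_sensingLaw {d : ℕ} (hd : 0 < d) {x : EuclideanSpace ℂ (Fin d)}
    (hx : ‖x‖ ^ 2 = d) (y : ℝ) :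
    ∫⁻ a, (p (absInner x a) y : ℝ≥0∞) ∂(sensingLaw d) = outDensity p y := by
  have hm : Measurable fun r => (p r y : ℝ≥0∞) :=
    hp.measurable_coe.comp measurable_prodMk_right
  rw [← lintegral_map (f := fun r => (p r y : ℝ≥0∞)) hm (measurable_absInner_right x),
    map_absInner_sensingLaw hd hx, lintegral_map hm (by fun_prop), outDensity]

/-- Where the marginal density vanishes, so does the conditional density for almost every sensing
vector. -/
lemma ae_density_eq_zero {d : ℕ} (hd : 0 < d) {x : EuclideanSpace ℂ (Fin d)}
    (hx : ‖x‖ ^ 2 = d) {y : ℝ} (hy : outDensity p y = 0) :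
    ∀ᵐ a ∂(sensingLaw d), (p (absInner x a) y : ℝ≥0∞) = 0 := by
  rw [← hp.lintegral_sensingLaw hd hx,
    lintegral_eq_zero_iff (hp.measurable_density_right x y)] at hy
  exact hy

lemma ae_outDensity_mul_lik {d : ℕ} (hd : 0 < d) {x : EuclideanSpace ℂ (Fin d)}
    (hx : ‖x‖ ^ 2 = d) : ∀ᵐ a ∂(sensingLaw d), ∀ᵐ y : ℝ,
      outDensity p y * lik p x (a, y) = p (absInner x a) y := by
  have hm : MeasurableSet {z : EuclideanSpace ℂ (Fin d) × ℝ |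
      outDensity p z.2 * lik p x (z.1, z.2) = p (absInner x z.1) z.2} :=
    measurableSet_eq_fun ((hp.measurable_outDensity.comp measurable_snd).mul
      (hp.measurable_lik_right x)) (hp.measurable_density.comp
      (f := fun z : EuclideanSpace ℂ (Fin d) × ℝ => (x, z)) measurable_prodMk_left)
  rw [Measure.ae_ae_comm hm]
  filter_upwards [hp.ae_outDensity_ne_top] with y hy
  by_cases h0 : outDensity p y = 0
  · filter_upwards [hp.ae_density_eq_zero hd hx h0] with a ha
    rw [ha, h0, zero_mul]
  · exact ae_of_all _ fun a => ENNReal.mul_div_cancel h0 hy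

lemma lintegral_prod_outLaw {d : ℕ} {F : EuclideanSpace ℂ (Fin d) × ℝ → ℝ≥0∞}
    (hF : Measurable F) :
    ∫⁻ b, F b ∂((sensingLaw d).prod (outLaw p))
      = ∫⁻ y, outDensity p y * ∫⁻ a, F (a, y) ∂(sensingLaw d) := by
  have := hp.isProbabilityMeasure_outLaw
  rw [lintegral_prod_symm _ hF.aemeasurable, outLaw,
    lintegral_withDensity_eq_lintegral_mul _ hp.measurable_outDensity hF.lintegral_prod_left']
  rfl

lemma lintegral_lik {d : ℕ} (hd : 0 < d) {x : EuclideanSpace ℂ (Fin d)} (hx : ‖x‖ ^ 2 = d) :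
    ∫⁻ b, lik p x b ∂((sensingLaw d).prod (outLaw p)) = 1 := by
  rw [hp.lintegral_prod_outLaw (hp.measurable_lik_right x), ← hp.lintegral_outDensity]
  refine lintegral_congr_ae ?_
  filter_upwards [hp.ae_outDensity_ne_top] with y hy
  simp only [lik, div_eq_mul_inv]
  rw [lintegral_mul_const _ (hp.measurable_density_right x y), hp.lintegral_sensingLaw hd hx]
  by_cases h0 : outDensity p y = 0
  · simp [h0]
  · rw [ENNReal.mul_inv_cancel h0 hy, mul_one]

/-- The correlation of the likelihood ratios of two signals is the function `f` of their overlap. -/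
lemma lintegral_lik_mul_lik {d : ℕ} (hd : 0 < d) {x x' : EuclideanSpace ℂ (Fin d)}
    (hx : ‖x‖ ^ 2 = d) (hx' : ‖x'‖ ^ 2 = d) :
    ∫⁻ b, lik p x b * lik p x' b ∂((sensingLaw d).prod (outLaw p)) = f p (overlap x x') := by
  rw [hp.lintegral_prod_outLaw (F := fun b => lik p x b * lik p x' b)
    ((hp.measurable_lik_right x).mul (hp.measurable_lik_right x')), f]
  refine lintegral_congr_ae ?_
  filter_upwards [hp.ae_outDensity_ne_top] with y hy
  have hm : Measurable fun r => (p r y : ℝ≥0∞) :=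
    hp.measurable_coe.comp measurable_prodMk_right
  rw [← lintegral_absInner_pair hd hx hx' (g := fun r r' => (p r y : ℝ≥0∞) * p r' y)
    ((hm.comp measurable_fst).mul (hm.comp measurable_snd))]
  change _ = _ / outDensity p y
  by_cases h0 : outDensity p y = 0
  · rw [h0, zero_mul, lintegral_congr_ae (g := fun _ => 0), lintegral_zero, ENNReal.zero_div]
    filter_upwards [hp.ae_density_eq_zero hd hx h0] with a ha
    rw [ha, zero_mul]
  · simp only [lik, div_eq_mul_inv]
    simp_rw [mul_mul_mul_comm _ (outDensity p y)⁻¹]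
    rw [lintegral_mul_const (f := fun a => (p (absInner x a) y : ℝ≥0∞) * p (absInner x' a) y) _
      ((hp.measurable_density_right x y).mul (hp.measurable_density_right x' y)), mul_left_comm,
      ← mul_assoc (outDensity p y), ENNReal.mul_inv_cancel h0 hy, one_mul]

end IsChannel

/-! ### Mixtures of likelihoods -/

section Mixture

variable {X Θ B : Type*} [MeasurableSpace X] [MeasurableSpace Θ] [MeasurableSpace B]

/-- The replica identity for the product of two mixtures. -/
lemma lintegral_mixture_mul {μ : Measure X} [SFinite μ] {τ : Measure Θ} [SFinite τ]
    {H K : X → Θ → ℝ≥0∞} (hH : Measurable (Function.uncurry H))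
    (hK : Measurable (Function.uncurry K)) :
    ∫⁻ θ, (∫⁻ x, H x θ ∂μ) * (∫⁻ x, K x θ ∂μ) ∂τ
      = ∫⁻ x, ∫⁻ x', ∫⁻ θ, H x θ * K x' θ ∂τ ∂μ ∂μ := by
  have hH' : ∀ θ, Measurable fun x => H x θ := fun θ => hH.comp (f := fun x => (x, θ)) (by fun_prop)
  have hK' : ∀ θ, Measurable fun x => K x θ := fun θ => hK.comp (f := fun x => (x, θ)) (by fun_prop)
  have h1 : ∀ θ, (∫⁻ x, H x θ ∂μ) * (∫⁻ x, K x θ ∂μ) = ∫⁻ z, H z.1 θ * K z.2 θ ∂(μ.prod μ) :=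
    fun θ => (lintegral_prod_mul (hH' θ).aemeasurable (hK' θ).aemeasurable).symm
  have hm : Measurable fun z : Θ × (X × X) => H z.2.1 z.1 * K z.2.2 z.1 :=
    (hH.comp (f := fun z : Θ × (X × X) => (z.2.1, z.1)) (by fun_prop)).mul
      (hK.comp (f := fun z : Θ × (X × X) => (z.2.2, z.1)) (by fun_prop))
  simp_rw [h1]
  rw [lintegral_lintegral_swap hm.aemeasurable, lintegral_prod]
  exact (Measurable.lintegral_prod_left' hm).aemeasurable

lemma enorm_toReal_sub_sq_add {a b : ℝ≥0∞} (ha : a ≠ ∞) (hb : b ≠ ∞) :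
    ‖a.toReal - b.toReal‖ₑ ^ 2 + 2 * (a * b) = a * a + b * b := by
  lift a to ℝ≥0 using ha
  lift b to ℝ≥0 using hb
  rw [← enorm_pow, Real.enorm_of_nonneg (sq_nonneg _)]
  simp only [ENNReal.coe_toReal]
  rw [← ENNReal.ofReal_coe_nnreal (p := a), ← ENNReal.ofReal_coe_nnreal (p := b),
    ← ENNReal.ofReal_mul a.coe_nonneg, ← ENNReal.ofReal_mul a.coe_nonneg,
    ← ENNReal.ofReal_mul b.coe_nonneg,
    ← ENNReal.ofReal_add (mul_nonneg a.coe_nonneg a.coe_nonneg)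
      (mul_nonneg b.coe_nonneg b.coe_nonneg), ← ENNReal.ofReal_ofNat 2,
    ← ENNReal.ofReal_mul (by norm_num),
    ← ENNReal.ofReal_add (sq_nonneg _)
      (mul_nonneg (by norm_num) (mul_nonneg a.coe_nonneg b.coe_nonneg))]
  congr 1
  ring

variable {μ : Measure X} {τ : Measure Θ} {β : Measure B} {H : X → Θ → ℝ≥0∞} {k : X → B → ℝ≥0∞}

lemma lintegral_likelihood_mul_eq_one [SFinite τ] [SFinite β] (hH : Measurable (Function.uncurry H))
    (hk : Measurable (Function.uncurry k)) (hH1 : ∀ᵐ x ∂μ, ∫⁻ θ, H x θ ∂τ = 1)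
    (hk1 : ∀ᵐ x ∂μ, ∫⁻ b, k x b ∂β = 1) :
    ∀ᵐ x ∂μ, ∫⁻ z, H x z.1 * k x z.2 ∂(τ.prod β) = 1 := by
  filter_upwards [hH1, hk1] with x h1 h2
  have hHx : Measurable (H x) := hH.comp measurable_prodMk_left
  have hkx : Measurable (k x) := hk.comp measurable_prodMk_left
  rw [lintegral_prod_mul hHx.aemeasurable hkx.aemeasurable, h1, h2, one_mul]

lemma measurable_likelihood_mul (hH : Measurable (Function.uncurry H))
    (hk : Measurable (Function.uncurry k)) :
    Measurable (Function.uncurry fun x (z : Θ × B) => H x z.1 * k x z.2) :=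
  (hH.comp (f := fun w : X × (Θ × B) => (w.1, w.2.1)) (by fun_prop)).mul
    (hk.comp (f := fun w : X × (Θ × B) => (w.1, w.2.2)) (by fun_prop))

variable [IsProbabilityMeasure μ] [IsProbabilityMeasure τ]

lemma lintegral_mixture_eq_one (hH : Measurable (Function.uncurry H))
    (hH1 : ∀ᵐ x ∂μ, ∫⁻ θ, H x θ ∂τ = 1) : ∫⁻ θ, ∫⁻ x, H x θ ∂μ ∂τ = 1 := by
  rw [lintegral_lintegral_swap, lintegral_congr_ae hH1, lintegral_one, measure_univ]
  exact (hH.comp measurable_swap).aemeasurable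

variable [IsProbabilityMeasure β]

/-- The mixture likelihood is a martingale in the number of observations: its increment is
orthogonal to the past, so that the second moment of the increment is the increment of the second
moments. -/
lemma lintegral_mixture_increment_sq (hH : Measurable (Function.uncurry H))
    (hk : Measurable (Function.uncurry k)) (hH1 : ∀ᵐ x ∂μ, ∫⁻ θ, H x θ ∂τ = 1)
    (hk1 : ∀ᵐ x ∂μ, ∫⁻ b, k x b ∂β = 1) :
    ∫⁻ z, ‖(∫⁻ x, H x z.1 * k x z.2 ∂μ).toReal - (∫⁻ x, H x z.1 ∂μ).toReal‖ₑ ^ 2 ∂(τ.prod β)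
        + 2 * ∫⁻ x, ∫⁻ x', ∫⁻ θ, H x θ * H x' θ ∂τ ∂μ ∂μ
      = (∫⁻ x, ∫⁻ x', (∫⁻ θ, H x θ * H x' θ ∂τ) * (∫⁻ b, k x b * k x' b ∂β) ∂μ ∂μ)
        + ∫⁻ x, ∫⁻ x', ∫⁻ θ, H x θ * H x' θ ∂τ ∂μ ∂μ := by
  have hHx : ∀ x, Measurable (H x) := fun x => hH.comp measurable_prodMk_left
  have hkx : ∀ x, Measurable (k x) := fun x => hk.comp measurable_prodMk_left
  have hHk := measurable_likelihood_mul hH hk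
  have hHz : Measurable (Function.uncurry fun x (z : Θ × B) => H x z.1) :=
    hH.comp (f := fun w : X × (Θ × B) => (w.1, w.2.1)) (by fun_prop)
  have hL' : Measurable fun z : Θ × B => ∫⁻ x, H x z.1 * k x z.2 ∂μ :=
    (hHk.comp measurable_swap).lintegral_prod_right'
  have hL : Measurable fun z : Θ × B => ∫⁻ x, H x z.1 ∂μ :=
    (hHz.comp measurable_swap).lintegral_prod_right'
  have e1 : ∫⁻ z, (∫⁻ x, H x z.1 * k x z.2 ∂μ) * (∫⁻ x, H x z.1 ∂μ) ∂(τ.prod β)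
      = ∫⁻ x, ∫⁻ x', ∫⁻ θ, H x θ * H x' θ ∂τ ∂μ ∂μ := by
    rw [lintegral_mixture_mul hHk hHz]
    refine lintegral_congr_ae ?_
    filter_upwards [hk1] with x hx
    refine lintegral_congr fun x' => ?_
    have : ∀ z : Θ × B, H x z.1 * k x z.2 * H x' z.1 = (H x z.1 * H x' z.1) * k x z.2 :=
      fun z => by ring
    simp_rw [this]
    rw [lintegral_prod_mul (f := fun θ => H x θ * H x' θ) ((hHx x).mul (hHx x')).aemeasurable
      (hkx x).aemeasurable, hx, mul_one]
  have e2 : ∫⁻ z, (∫⁻ x, H x z.1 * k x z.2 ∂μ) * (∫⁻ x, H x z.1 * k x z.2 ∂μ) ∂(τ.prod β)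
      = ∫⁻ x, ∫⁻ x', (∫⁻ θ, H x θ * H x' θ ∂τ) * (∫⁻ b, k x b * k x' b ∂β) ∂μ ∂μ := by
    rw [lintegral_mixture_mul hHk hHk]
    refine lintegral_congr fun x => lintegral_congr fun x' => ?_
    have : ∀ z : Θ × B, H x z.1 * k x z.2 * (H x' z.1 * k x' z.2)
        = (H x z.1 * H x' z.1) * (k x z.2 * k x' z.2) := fun z => by ring
    simp_rw [this]
    rw [lintegral_prod_mul (f := fun θ => H x θ * H x' θ) (g := fun b => k x b * k x' b)
      ((hHx x).mul (hHx x')).aemeasurable ((hkx x).mul (hkx x')).aemeasurable]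
  have e3 : ∫⁻ z, (∫⁻ x, H x z.1 ∂μ) * (∫⁻ x, H x z.1 ∂μ) ∂(τ.prod β)
      = ∫⁻ x, ∫⁻ x', ∫⁻ θ, H x θ * H x' θ ∂τ ∂μ ∂μ := by
    rw [lintegral_mixture_mul hHz hHz]
    refine lintegral_congr fun x => lintegral_congr fun x' => ?_
    have h := lintegral_prod_mul (μ := τ) (ν := β) (f := fun θ => H x θ * H x' θ)
      (g := fun _ => 1) ((hHx x).mul (hHx x')).aemeasurable aemeasurable_const
    simpa using h
  have hfin' : ∀ᵐ z ∂(τ.prod β), (∫⁻ x, H x z.1 * k x z.2 ∂μ) < ∞ :=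
    ae_lt_top hL' (by
      rw [lintegral_mixture_eq_one hHk (lintegral_likelihood_mul_eq_one hH hk hH1 hk1)]; simp)
  have hfin : ∀ᵐ z ∂(τ.prod β), (∫⁻ x, H x z.1 ∂μ) < ∞ := by
    refine ae_lt_top hL ?_
    rw [lintegral_mixture_eq_one hHz]
    · simp
    · filter_upwards [hH1] with x hx
      have h := lintegral_prod_mul (μ := τ) (ν := β) (f := H x) (g := fun _ => 1)
        (hHx x).aemeasurable aemeasurable_const
      simpa [hx] using h
  rw [← e1, ← e2]
  conv_rhs => rw [e1, ← e3]
  have hLL : Measurable fun z : Θ × B => (∫⁻ x, H x z.1 ∂μ) * ∫⁻ x, H x z.1 ∂μ := hL.mul hL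
  have hLL' : Measurable fun z : Θ × B =>
      (∫⁻ x, H x z.1 * k x z.2 ∂μ) * ∫⁻ x, H x z.1 ∂μ := hL'.mul hL
  rw [← lintegral_const_mul _ hLL', ← lintegral_add_right _ (hLL'.const_mul 2),
    ← lintegral_add_right _ hLL]
  refine lintegral_congr_ae ?_
  filter_upwards [hfin', hfin] with z h1 h2
  exact enorm_toReal_sub_sq_add h1.ne h2.ne

/-- A bounded statistic `w` that is centered given the past has a small mean under the mixture when
the second moment of the mixture likelihood increases by little. -/
lemma abs_integral_mixture_le (hH : Measurable (Function.uncurry H))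
    (hk : Measurable (Function.uncurry k)) (hH1 : ∀ᵐ x ∂μ, ∫⁻ θ, H x θ ∂τ = 1)
    (hk1 : ∀ᵐ x ∂μ, ∫⁻ b, k x b ∂β = 1)
    (hfin : ∫⁻ x, ∫⁻ x', ∫⁻ θ, H x θ * H x' θ ∂τ ∂μ ∂μ ≠ ∞) {ε : ℝ} (hε : 0 ≤ ε)
    (hinc : ∫⁻ x, ∫⁻ x', (∫⁻ θ, H x θ * H x' θ ∂τ) * (∫⁻ b, k x b * k x' b ∂β) ∂μ ∂μ
      ≤ (∫⁻ x, ∫⁻ x', ∫⁻ θ, H x θ * H x' θ ∂τ ∂μ ∂μ) + ENNReal.ofReal ε)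
    {w : Θ × B → ℝ} (hw : Measurable w) {C : ℝ} (hC : ∀ z, |w z| ≤ C)
    (hw0 : ∀ θ, ∫ b, w (θ, b) ∂β = 0) :
    |∫ q, w q.2 * (H q.1 q.2.1 * k q.1 q.2.2).toReal ∂(μ.prod (τ.prod β))| ≤ C * √ε := by
  have hHk := measurable_likelihood_mul hH hk
  have hHk1 := lintegral_likelihood_mul_eq_one hH hk hH1 hk1
  have hL'm : Measurable fun z : Θ × B => ∫⁻ x, H x z.1 * k x z.2 ∂μ :=
    (hHk.comp measurable_swap).lintegral_prod_right'
  have hLm : Measurable fun θ => ∫⁻ x, H x θ ∂μ :=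
    (hH.comp measurable_swap).lintegral_prod_right'
  have hC0 : 0 ≤ C := by
    obtain ⟨z⟩ : Nonempty (Θ × B) := (τ.prod β).nonempty_of_neZero
    exact (abs_nonneg _).trans (hC z)
  set L' : Θ × B → ℝ := fun z => (∫⁻ x, H x z.1 * k x z.2 ∂μ).toReal with hL'
  set L : Θ → ℝ := fun θ => (∫⁻ x, H x θ ∂μ).toReal with hL
  have hL'i : Integrable L' (τ.prod β) :=
    integrable_toReal_of_lintegral_ne_top hL'm.aemeasurable
      (by rw [lintegral_mixture_eq_one hHk hHk1]; simp)
  have hLi : Integrable L τ :=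
    integrable_toReal_of_lintegral_ne_top hLm.aemeasurable
      (by rw [lintegral_mixture_eq_one hH hH1]; simp)
  have hLi' : Integrable (fun z : Θ × B => L z.1) (τ.prod β) := hLi.comp_fst β
  have hwb : ∀ᵐ z ∂(τ.prod β), ‖w z‖ ≤ C := ae_of_all _ hC
  -- the mean under the mixture
  have h1 : ∫ q, w q.2 * (H q.1 q.2.1 * k q.1 q.2.2).toReal ∂(μ.prod (τ.prod β))
      = ∫ z, w z * L' z ∂(τ.prod β) := by
    rw [integral_prod_symm]
    · refine integral_congr_ae ?_
      have : ∀ᵐ z ∂(τ.prod β), (∫⁻ x, H x z.1 * k x z.2 ∂μ) < ∞ :=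
        ae_lt_top hL'm (by rw [lintegral_mixture_eq_one hHk hHk1]; simp)
      filter_upwards [this] with z hz
      have hmz : Measurable fun x => H x z.1 * k x z.2 :=
        hHk.comp (f := fun x => (x, z)) (by fun_prop)
      simp only [integral_const_mul]
      rw [integral_toReal hmz.aemeasurable (ae_lt_top hmz hz.ne)]
    · refine Integrable.bdd_mul (c := C) ?_ (hw.comp measurable_snd).aestronglyMeasurable
        (ae_of_all _ fun q => hC q.2)
      refine integrable_toReal_of_lintegral_ne_top hHk.aemeasurable ?_
      change ∫⁻ q, Function.uncurry (fun x (z : Θ × B) => H x z.1 * k x z.2) q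
        ∂(μ.prod (τ.prod β)) ≠ ∞
      rw [lintegral_prod _ hHk.aemeasurable]
      simp only [Function.uncurry_apply_pair]
      rw [lintegral_congr_ae hHk1]
      simp
  -- the mean vanishes when the last observation is independent of the past
  have h2 : ∫ z, w z * L z.1 ∂(τ.prod β) = 0 := by
    rw [integral_prod _ (hLi'.bdd_mul hw.aestronglyMeasurable hwb)]
    simp [integral_mul_const, hw0]
  have h3 : ∫⁻ z, ‖L' z - L z.1‖ₑ ^ 2 ∂(τ.prod β) ≤ ENNReal.ofReal ε := by
    have h := lintegral_mixture_increment_sq hH hk hH1 hk1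
    have h' := h.le.trans (add_le_add_left hinc _)
    rw [two_mul, add_right_comm, add_comm _ (ENNReal.ofReal ε)] at h'
    exact (ENNReal.add_le_add_iff_right (ENNReal.add_ne_top.2 ⟨hfin, hfin⟩)).1 h'
  set D : Θ × B → ℝ := fun z => L' z - L z.1 with hD
  have hDi : Integrable D (τ.prod β) := hL'i.sub hLi'
  have h4 : ∫ z, ‖D z‖ ∂(τ.prod β) ≤ √ε := by
    have h := eLpNorm_le_eLpNorm_of_exponent_le (p := 1) (q := 2) (by norm_num)
      hDi.aestronglyMeasurable
    rw [eLpNorm_one_eq_lintegral_enorm, eLpNorm_eq_lintegral_rpow_enorm_toReal (by norm_num)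
      (by norm_num)] at h
    rw [integral_norm_eq_lintegral_enorm hDi.aestronglyMeasurable, Real.sqrt_eq_rpow]
    refine ENNReal.toReal_le_of_le_ofReal (by positivity) (h.trans ?_)
    rw [← ENNReal.ofReal_rpow_of_nonneg hε (by norm_num)]
    simp only [ENNReal.toReal_ofNat, ENNReal.rpow_ofNat]
    exact ENNReal.rpow_le_rpow h3 (by norm_num)
  have h5 : ∫ z, w z * L' z ∂(τ.prod β) = ∫ z, w z * D z ∂(τ.prod β) := by
    rw [← sub_zero (∫ z, w z * L' z ∂(τ.prod β)), ← h2, ← integral_sub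
      (hL'i.bdd_mul hw.aestronglyMeasurable hwb) (hLi'.bdd_mul hw.aestronglyMeasurable hwb)]
    simp only [hD, mul_sub]
  rw [h1, h5, ← Real.norm_eq_abs]
  calc ‖∫ z, w z * D z ∂(τ.prod β)‖ ≤ ∫ z, ‖w z * D z‖ ∂(τ.prod β) :=
        norm_integral_le_integral_norm _
    _ ≤ ∫ z, C * ‖D z‖ ∂(τ.prod β) := by
        refine integral_mono (hDi.bdd_mul hw.aestronglyMeasurable hwb).norm
          (hDi.norm.const_mul C) fun z => ?_
        rw [norm_mul]
        exact mul_le_mul_of_nonneg_right (hC z) (norm_nonneg _)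
    _ ≤ C * √ε := by
        rw [integral_const_mul]
        exact mul_le_mul_of_nonneg_left h4 hC0

end Mixture

/-! ### The model as a product measure with a density -/

lemma pi_withDensity_fin {B : Type*} [MeasurableSpace B] (β : Measure B) [SigmaFinite β]
    {g : B → ℝ≥0∞} (hg : Measurable g) [SigmaFinite (β.withDensity g)] (n : ℕ) :
    (Measure.pi fun _ : Fin n => β.withDensity g)
      = (Measure.pi fun _ : Fin n => β).withDensity fun b => ∏ i, g (b i) := by
  refine Measure.pi_eq fun s hs => ?_
  have hind : ∀ b : Fin n → B, (Set.univ.pi s).indicator (fun b => ∏ i, g (b i)) b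
      = ∏ i, (s i).indicator g (b i) := by
    intro b
    by_cases h : b ∈ Set.univ.pi s
    · rw [Set.indicator_of_mem h]
      exact Finset.prod_congr rfl fun i _ => (Set.indicator_of_mem (h i (Set.mem_univ i)) g).symm
    · rw [Set.indicator_of_notMem h]
      obtain ⟨i, hi⟩ : ∃ i, b i ∉ s i := by simpa [Set.mem_pi] using h
      exact (Finset.prod_eq_zero (Finset.mem_univ i) (Set.indicator_of_notMem hi g)).symm
  rw [withDensity_apply _ (MeasurableSet.univ_pi hs),
    ← lintegral_indicator (MeasurableSet.univ_pi hs), lintegral_congr hind,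
    lintegral_pi_fin_prod β fun i => hg.indicator (hs i)]
  exact Finset.prod_congr rfl fun i _ => by
    rw [lintegral_indicator (hs i), withDensity_apply _ (hs i)]

/-- The joint likelihood ratio of the signal `x` for the observations `θ`. -/
noncomputable def jointLik (p : ℝ≥0 → ℝ → ℝ≥0) {d n : ℕ} (x : EuclideanSpace ℂ (Fin d))
    (θ : Fin n → EuclideanSpace ℂ (Fin d) × ℝ) : ℝ≥0∞ :=
  ∏ i, lik p x (θ i)

/-- The data consisting of the observations `z.1` and the new sensing vector `z.2`. -/
def gather {d n : ℕ} (z : (Fin n → EuclideanSpace ℂ (Fin d) × ℝ) × EuclideanSpace ℂ (Fin d)) :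
    (Fin (n + 1) → EuclideanSpace ℂ (Fin d)) × (Fin n → ℝ) :=
  (Fin.snoc (fun i => (z.1 i).1) z.2, fun i => (z.1 i).2)

lemma measurePreserving_gather {d n : ℕ} (σ : Measure (EuclideanSpace ℂ (Fin d)))
    [IsProbabilityMeasure σ] (ν : Measure ℝ) [IsProbabilityMeasure ν] :
    MeasurePreserving (gather (d := d) (n := n))
      ((Measure.pi fun _ : Fin n => σ.prod ν).prod σ)
      ((Measure.pi fun _ : Fin (n + 1) => σ).prod (Measure.pi fun _ : Fin n => ν)) := by
  have h1 := (measurePreserving_arrowProdEquivProdArrow (EuclideanSpace ℂ (Fin d)) ℝ (Fin n)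
    (fun _ => σ) (fun _ => ν)).prod (MeasurePreserving.id σ)
  have h2 : MeasurePreserving Prod.swap (((Measure.pi fun _ : Fin n => σ).prod
      (Measure.pi fun _ : Fin n => ν)).prod σ) _ := Measure.measurePreserving_swap
  have h3 := (measurePreserving_prodAssoc σ (Measure.pi fun _ : Fin n => σ)
    (Measure.pi fun _ : Fin n => ν)).symm
  have h4 := ((measurePreserving_piFinSuccAbove (fun _ : Fin (n + 1) => σ) (Fin.last n)).symm).prod
    (MeasurePreserving.id (Measure.pi fun _ : Fin n => ν))
  have h := h4.comp (h3.comp (h2.comp h1))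
  convert h using 1
  funext z
  refine Prod.ext (funext fun j => ?_) rfl
  refine Fin.lastCases ?_ (fun i => ?_) j
  · simp [gather, MeasurableEquiv.prodAssoc]
  · simp [gather, MeasurableEquiv.prodAssoc]
    rfl

/-- The outcome with signal `q.1`, observations `q.2.1` and new sensing vector `q.2.2`. -/
def assemble {d n : ℕ} (q : EuclideanSpace ℂ (Fin d) ×
    (Fin n → EuclideanSpace ℂ (Fin d) × ℝ) × EuclideanSpace ℂ (Fin d)) : Outcome d n :=
  (q.1, gather q.2)

@[fun_prop]
lemma measurable_gather {d n : ℕ} : Measurable (gather (d := d) (n := n)) := by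
  refine Measurable.prodMk (measurable_pi_iff.2 fun j => ?_) (by fun_prop)
  refine Fin.lastCases ?_ (fun i => ?_) j
  · simpa using measurable_snd
  · simp only [Fin.snoc_castSucc]
    fun_prop

@[fun_prop]
lemma measurable_assemble {d n : ℕ} : Measurable (assemble (d := d) (n := n)) :=
  measurable_fst.prodMk (measurable_gather.comp measurable_snd)

namespace IsChannel

variable {p : ℝ≥0 → ℝ → ℝ≥0} (hp : IsChannel p)
include hp

lemma measurable_jointLik {d n : ℕ} :
    Measurable (Function.uncurry (jointLik p (d := d) (n := n))) := by
  have h : Measurable fun z : EuclideanSpace ℂ (Fin d) ×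
      (Fin n → EuclideanSpace ℂ (Fin d) × ℝ) => ∏ i, lik p z.1 (z.2 i) :=
    Finset.measurable_prod _ fun i _ => hp.measurable_lik.comp
      (f := fun z : EuclideanSpace ℂ (Fin d) × (Fin n → EuclideanSpace ℂ (Fin d) × ℝ) =>
        (z.1, z.2 i)) (by fun_prop)
  exact h

lemma model_eq_withDensity {d n : ℕ} [NeZero d] :
    model p d n = ((signalLaw d).prod ((Measure.pi fun _ : Fin (n + 1) => sensingLaw d).prod
      (Measure.pi fun _ : Fin n => outLaw p))).withDensity
        fun ω => ∏ i : Fin n, lik p ω.1 (ω.2.1 i.castSucc, ω.2.2 i) := by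
  have := hp.isProbabilityMeasure_outLaw
  have hsf : SigmaFinite (volume.withDensity (outDensity p)) :=
    inferInstanceAs (SigmaFinite (outLaw p))
  have hg : Measurable fun y : Fin n → ℝ => ∏ i, outDensity p (y i) :=
    Finset.measurable_prod _ fun i _ => hp.measurable_outDensity.comp (measurable_pi_apply i)
  have hl : Measurable fun ω : Outcome d n => ∏ i : Fin n, lik p ω.1 (ω.2.1 i.castSucc, ω.2.2 i) :=
    Finset.measurable_prod _ fun i _ => hp.measurable_lik.comp
      (f := fun ω : Outcome d n => (ω.1, (ω.2.1 i.castSucc, ω.2.2 i))) (by fun_prop)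
  have hpm : Measurable fun ω : Outcome d n =>
      ∏ i : Fin n, (p (absInner ω.1 (ω.2.1 i.castSucc)) (ω.2.2 i) : ℝ≥0∞) :=
    Finset.measurable_prod _ fun i _ => hp.measurable_density.comp
      (f := fun ω : Outcome d n => (ω.1, (ω.2.1 i.castSucc, ω.2.2 i))) (by fun_prop)
  have hsf' : SFinite ((Measure.pi fun _ : Fin (n + 1) => sensingLaw d).prod
      (Measure.pi fun _ : Fin n => (volume : Measure ℝ))) := Measure.prod.instSFinite
  unfold outLaw
  have hg1 : Measurable fun z : (Fin (n + 1) → EuclideanSpace ℂ (Fin d)) × (Fin n → ℝ) =>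
      ∏ i, outDensity p (z.2 i) := hg.comp measurable_snd
  have hg2 : Measurable fun ω : Outcome d n => ∏ i, outDensity p (ω.2.2 i) :=
    hg1.comp measurable_snd
  rw [pi_withDensity_fin _ hp.measurable_outDensity, prod_withDensity_right hg,
    prod_withDensity_right hg1, ← withDensity_mul _ hg2 hl, model, volume_pi]
  refine withDensity_congr_ae ?_
  have hd : 0 < d := NeZero.pos d
  have hae : ∀ᵐ x ∂(signalLaw d), ∀ᵐ z ∂((Measure.pi fun _ : Fin (n + 1) => sensingLaw d).prod
      (Measure.pi fun _ : Fin n => (volume : Measure ℝ))),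
      (∏ i : Fin n, (p (absInner x (z.1 i.castSucc)) (z.2 i) : ℝ≥0∞))
        = (∏ i, outDensity p (z.2 i)) * ∏ i : Fin n, lik p x (z.1 i.castSucc, z.2 i) := by
    filter_upwards [ae_signalLaw_norm_sq d] with x hx
    rw [Measure.ae_prod_iff_ae_ae]
    · have h := hp.ae_outDensity_mul_lik hd hx
      have h1 : ∀ᵐ a ∂(Measure.pi fun _ : Fin (n + 1) => sensingLaw d), ∀ i : Fin n, ∀ᵐ y : ℝ,
          outDensity p y * lik p x (a i.castSucc, y) = p (absInner x (a i.castSucc)) y :=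
        ae_all_iff.2 fun i => (Measure.quasiMeasurePreserving_eval (μ := fun _ : Fin (n + 1) =>
          sensingLaw d) i.castSucc).ae h
      filter_upwards [h1] with a ha
      have h2 : ∀ᵐ y ∂(Measure.pi fun _ : Fin n => (volume : Measure ℝ)), ∀ i : Fin n,
          outDensity p (y i) * lik p x (a i.castSucc, y i) = p (absInner x (a i.castSucc)) (y i) :=
        ae_all_iff.2 fun i => (Measure.quasiMeasurePreserving_eval (μ := fun _ : Fin n =>
          (volume : Measure ℝ)) i).ae (ha i)
      filter_upwards [h2] with y hy
      rw [← Finset.prod_mul_distrib]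
      exact Finset.prod_congr rfl fun i _ => (hy i).symm
    · exact measurableSet_eq_fun (hpm.comp (f := fun z => (x, z)) measurable_prodMk_left)
        (hg1.mul (hl.comp (f := fun z => (x, z)) measurable_prodMk_left))
  exact (Measure.ae_prod_iff_ae_ae (measurableSet_eq_fun hpm
    (hg2.mul hl))).2 hae

lemma model_eq_map {d n : ℕ} [NeZero d] :
    model p d n = (((signalLaw d).prod ((Measure.pi fun _ : Fin n =>
      (sensingLaw d).prod (outLaw p)).prod (sensingLaw d))).withDensity
        fun q => jointLik p q.1 q.2.1).map assemble := by
  have := hp.isProbabilityMeasure_outLaw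
  have hT : MeasurePreserving (assemble (d := d) (n := n)) _ _ :=
    (MeasurePreserving.id (signalLaw d)).prod
      (measurePreserving_gather (n := n) (sensingLaw d) (outLaw p))
  have hl : Measurable fun ω : Outcome d n => ∏ i : Fin n, lik p ω.1 (ω.2.1 i.castSucc, ω.2.2 i) :=
    Finset.measurable_prod _ fun i _ => hp.measurable_lik.comp
      (f := fun ω : Outcome d n => (ω.1, (ω.2.1 i.castSucc, ω.2.2 i))) (by fun_prop)
  rw [hp.model_eq_withDensity, ← hT.map_eq]
  ext s hs
  rw [withDensity_apply _ hs, Measure.map_apply hT.measurable hs,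
    withDensity_apply _ (hT.measurable hs), setLIntegral_map hs hl hT.measurable]
  simp [assemble, gather, jointLik]

end IsChannel

/-! ### The second moment of the likelihood ratio -/

/-- The second moment of the likelihood ratio between the model with `n` measurements and the one
whose measurements are independent of the sensing vectors. -/
noncomputable def secondMoment (p : ℝ≥0 → ℝ → ℝ≥0) (d n : ℕ) : ℝ≥0∞ :=
  ∫⁻ x, ∫⁻ x', f p (overlap x x') ^ n ∂(signalLaw d) ∂(signalLaw d)

lemma measurable_absInner_last {d n : ℕ} :
    Measurable fun ω : Outcome d n => absInner ω.1 (ω.2.1 (Fin.last n)) :=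
  measurable_absInner.comp (f := fun ω : Outcome d n => (ω.1, ω.2.1 (Fin.last n))) (by fun_prop)

namespace IsChannel

variable {p : ℝ≥0 → ℝ → ℝ≥0} (hp : IsChannel p)
include hp

lemma ae_lintegral_jointLik (d n : ℕ) [NeZero d] : ∀ᵐ x ∂(signalLaw d),
    ∫⁻ θ, jointLik p (n := n) x θ ∂(Measure.pi fun _ => (sensingLaw d).prod (outLaw p)) = 1 := by
  have := hp.isProbabilityMeasure_outLaw
  filter_upwards [ae_signalLaw_norm_sq d] with x hx
  unfold jointLik
  rw [lintegral_pi_fin_prod _ fun _ => hp.measurable_lik_right x]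
  simp [hp.lintegral_lik (NeZero.pos d) hx]

lemma lintegral_jointLik_mul_jointLik {d n : ℕ} [NeZero d] {x x' : EuclideanSpace ℂ (Fin d)}
    (hx : ‖x‖ ^ 2 = d) (hx' : ‖x'‖ ^ 2 = d) :
    ∫⁻ θ, jointLik p (n := n) x θ * jointLik p x' θ
      ∂(Measure.pi fun _ => (sensingLaw d).prod (outLaw p)) = f p (overlap x x') ^ n := by
  have := hp.isProbabilityMeasure_outLaw
  unfold jointLik
  simp_rw [← Finset.prod_mul_distrib]
  rw [lintegral_pi_fin_prod _ (f := fun _ b => lik p x b * lik p x' b)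
    fun _ => (hp.measurable_lik_right x).mul (hp.measurable_lik_right x')]
  simp [hp.lintegral_lik_mul_lik (NeZero.pos d) hx hx']

lemma lintegral_jointLik_eq_secondMoment (d n : ℕ) [NeZero d] :
    ∫⁻ x, ∫⁻ x', ∫⁻ θ, jointLik p (n := n) x θ * jointLik p x' θ
      ∂(Measure.pi fun _ => (sensingLaw d).prod (outLaw p)) ∂(signalLaw d) ∂(signalLaw d)
      = secondMoment p d n := by
  refine lintegral_congr_ae ?_
  filter_upwards [ae_signalLaw_norm_sq d] with x hx
  refine lintegral_congr_ae ?_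
  filter_upwards [ae_signalLaw_norm_sq d] with x' hx'
  exact hp.lintegral_jointLik_mul_jointLik hx hx'

lemma lintegral_jointLik_mul_lik_eq_secondMoment (d n : ℕ) [NeZero d] :
    ∫⁻ x, ∫⁻ x', (∫⁻ θ, jointLik p (n := n) x θ * jointLik p x' θ
      ∂(Measure.pi fun _ => (sensingLaw d).prod (outLaw p)))
        * (∫⁻ b, lik p x b * lik p x' b ∂((sensingLaw d).prod (outLaw p)))
        ∂(signalLaw d) ∂(signalLaw d)
      = secondMoment p d (n + 1) := by
  refine lintegral_congr_ae ?_
  filter_upwards [ae_signalLaw_norm_sq d] with x hx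
  refine lintegral_congr_ae ?_
  filter_upwards [ae_signalLaw_norm_sq d] with x' hx'
  rw [hp.lintegral_jointLik_mul_jointLik hx hx', hp.lintegral_lik_mul_lik (NeZero.pos d) hx hx',
    pow_succ]

lemma map_absInner_model (d n : ℕ) [NeZero d] :
    (model p d n).map (fun ω => absInner ω.1 (ω.2.1 (Fin.last n)))
      = (complexNormal 1).map (fun g => ‖g‖₊) := by
  have := hp.isProbabilityMeasure_outLaw
  have hm := measurable_absInner_last (d := d) (n := n)
  have hJ : Measurable fun q : EuclideanSpace ℂ (Fin d) ×
      (Fin n → EuclideanSpace ℂ (Fin d) × ℝ) × EuclideanSpace ℂ (Fin d) =>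
      jointLik p q.1 q.2.1 :=
    hp.measurable_jointLik.comp (f := fun q : EuclideanSpace ℂ (Fin d) ×
      (Fin n → EuclideanSpace ℂ (Fin d) × ℝ) × EuclideanSpace ℂ (Fin d) => (q.1, q.2.1))
      (by fun_prop)
  rw [hp.model_eq_map, Measure.map_map hm measurable_assemble]
  have hcomp : (fun ω : Outcome d n => absInner ω.1 (ω.2.1 (Fin.last n))) ∘ assemble
      = fun q => absInner q.1 q.2.2 := by
    ext q; simp [assemble, gather]
  rw [hcomp]
  have hm2 : Measurable fun q : EuclideanSpace ℂ (Fin d) ×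
      (Fin n → EuclideanSpace ℂ (Fin d) × ℝ) × EuclideanSpace ℂ (Fin d) => absInner q.1 q.2.2 :=
    measurable_absInner.comp (f := fun q : EuclideanSpace ℂ (Fin d) ×
      (Fin n → EuclideanSpace ℂ (Fin d) × ℝ) × EuclideanSpace ℂ (Fin d) => (q.1, q.2.2))
      (by fun_prop)
  ext s hs
  rw [Measure.map_apply hm2 hs, withDensity_apply _ (hm2 hs), ← lintegral_indicator (hm2 hs),
    lintegral_prod _ (hJ.indicator (hm2 hs)).aemeasurable]
  have key : ∀ᵐ x ∂(signalLaw d), ∫⁻ z : (Fin n → EuclideanSpace ℂ (Fin d) × ℝ) ×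
        EuclideanSpace ℂ (Fin d),
      ((fun q : EuclideanSpace ℂ (Fin d) × (Fin n → EuclideanSpace ℂ (Fin d) × ℝ) ×
        EuclideanSpace ℂ (Fin d) => absInner q.1 q.2.2) ⁻¹' s).indicator
        (fun q => jointLik p q.1 q.2.1) (x, z)
        ∂((Measure.pi fun _ => (sensingLaw d).prod (outLaw p)).prod (sensingLaw d))
      = (complexNormal 1).map (fun g => ‖g‖₊) s := by
    filter_upwards [ae_signalLaw_norm_sq d, hp.ae_lintegral_jointLik d n] with x hx hx1
    have hmx := measurable_absInner_right x
    have hJx : Measurable (jointLik p (n := n) x) := hp.measurable_jointLik.comp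
      (g := Function.uncurry (jointLik p)) (f := fun θ => (x, θ)) measurable_prodMk_left
    rw [← map_absInner_sensingLaw (NeZero.pos d) hx, Measure.map_apply hmx hs,
      ← lintegral_indicator_one (hmx hs),
      ← one_mul (∫⁻ a, (absInner x ⁻¹' s).indicator 1 a ∂(sensingLaw d)), ← hx1,
      ← lintegral_prod_mul hJx.aemeasurable (measurable_one.indicator (hmx hs)).aemeasurable]
    refine lintegral_congr fun z => ?_
    by_cases h : absInner x z.2 ∈ s
    · simp [Set.indicator, h]
    · simp [Set.indicator, h]
  rw [lintegral_congr_ae key]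
  simp

lemma isProbabilityMeasure_model (d n : ℕ) [NeZero d] : IsProbabilityMeasure (model p d n) := by
  have hm := measurable_absInner_last (d := d) (n := n)
  have h1 : IsProbabilityMeasure ((complexNormal 1).map (fun g : ℂ => ‖g‖₊)) :=
    Measure.isProbabilityMeasure_map (by fun_prop)
  rw [← hp.map_absInner_model d n] at h1
  exact (Measure.isProbabilityMeasure_map_iff hm.aemeasurable).1 h1

variable {ϕ : ℝ → ℝ}

lemma measurable_smoothed (hϕ : Measurable ϕ) : Measurable (smoothed p ϕ) := by
  have hm : Measurable (Function.uncurry fun (r : ℝ≥0) (y : ℝ) => ϕ y * (p r y : ℝ)) :=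
    (hϕ.comp measurable_snd).mul (measurable_coe_nnreal_real.comp hp.measurable)
  exact hm.stronglyMeasurable.integral_prod_right.measurable

lemma measurable_target (hϕ : Measurable ϕ) (d n : ℕ) : Measurable (target p ϕ d n) :=
  (hp.measurable_smoothed hϕ).comp measurable_absInner_last

lemma integrable_density (r : ℝ≥0) : Integrable fun y => (p r y : ℝ) := by
  have hm : Measurable (p r) := hp.measurable.comp measurable_prodMk_left
  have := integrable_toReal_of_lintegral_ne_top
    (measurable_coe_nnreal_ennreal.comp hm).aemeasurable
    (μ := volume) (by simp [hp.lintegral_eq_one r])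
  simpa using this

lemma integral_density (r : ℝ≥0) : ∫ y, (p r y : ℝ) = 1 := by
  have hm : Measurable (p r) := hp.measurable.comp measurable_prodMk_left
  have := integral_toReal (μ := volume) (measurable_coe_nnreal_ennreal.comp hm).aemeasurable
    (ae_of_all _ fun y => by simp)
  simpa [hp.lintegral_eq_one r] using this

lemma norm_smoothed_le {K : ℝ} (hK : ∀ y, |ϕ y| ≤ K)
    (r : ℝ≥0) : |smoothed p ϕ r| ≤ K := by
  rw [smoothed, ← Real.norm_eq_abs]
  refine (norm_integral_le_of_norm_le ((hp.integrable_density r).const_mul K)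
    (ae_of_all _ fun y => ?_)).trans ?_
  · rw [norm_mul, Real.norm_of_nonneg (p r y).coe_nonneg]
    exact mul_le_mul_of_nonneg_right (hK y) (p r y).coe_nonneg
  · rw [integral_const_mul, hp.integral_density, mul_one]

lemma variance_target (hϕ : Measurable ϕ) (d n : ℕ) [NeZero d] :
    Var[target p ϕ d n; model p d n]
      = Var[fun g : ℂ => smoothed p ϕ ‖g‖₊; complexNormal 1] := by
  have hm := measurable_absInner_last (d := d) (n := n)
  have hs := hp.measurable_smoothed hϕ
  have h1 := variance_map (μ := model p d n) hs.aemeasurable hm.aemeasurable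
  have h2 := variance_map (μ := complexNormal 1) (Y := fun g : ℂ => ‖g‖₊) hs.aemeasurable
    (by fun_prop)
  rw [hp.map_absInner_model, h2] at h1
  exact h1.symm

/-! ### Correlation of the target with the data -/

lemma integrable_of_bounded_outLaw (hϕ : Measurable ϕ) {K : ℝ} (hK : ∀ y, |ϕ y| ≤ K) :
    Integrable ϕ (outLaw p) := by
  have := hp.isProbabilityMeasure_outLaw
  exact Integrable.of_bound hϕ.aestronglyMeasurable K (ae_of_all _ hK)

lemma abs_integral_outLaw_le {K : ℝ} (hK : ∀ y, |ϕ y| ≤ K) :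
    |∫ y, ϕ y ∂(outLaw p)| ≤ K := by
  have := hp.isProbabilityMeasure_outLaw
  simpa using norm_integral_le_of_norm_le_const (μ := outLaw p) (f := ϕ) (ae_of_all _ hK)

/-- Averaging a statistic over the new measurement gives its conditional mean given the signal. -/
lemma ae_integral_sub_mul_lik (hϕ : Measurable ϕ) {K : ℝ} (hK : ∀ y, |ϕ y| ≤ K) (b : ℝ)
    {d : ℕ} [NeZero d] {x : EuclideanSpace ℂ (Fin d)} (hx : ‖x‖ ^ 2 = d) :
    ∀ᵐ a ∂(sensingLaw d), ∫ y, (ϕ y - b) * (lik p x (a, y)).toReal ∂(outLaw p)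
      = smoothed p ϕ (absInner x a) - b := by
  filter_upwards [hp.ae_outDensity_mul_lik (NeZero.pos d) hx] with a ha
  have hq : ∀ᵐ y : ℝ, outDensity p y < ∞ := hp.ae_outDensity_ne_top.mono fun _ h => h.lt_top
  rw [outLaw, integral_withDensity_eq_integral_toReal_smul hp.measurable_outDensity hq]
  have h1 : ∀ᵐ y : ℝ, (outDensity p y).toReal • ((ϕ y - b) * (lik p x (a, y)).toReal)
      = ϕ y * (p (absInner x a) y : ℝ) - b * (p (absInner x a) y : ℝ) := by
    filter_upwards [ha] with y hy
    have h2 : (outDensity p y).toReal * (lik p x (a, y)).toReal = (p (absInner x a) y : ℝ) := by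
      rw [← ENNReal.toReal_mul, hy, ENNReal.coe_toReal]
    rw [smul_eq_mul, mul_left_comm, h2, sub_mul]
  have hi := hp.integrable_density (absInner x a)
  rw [integral_congr_ae h1, integral_sub (hi.bdd_mul hϕ.aestronglyMeasurable (ae_of_all _ hK))
    (hi.const_mul b), integral_const_mul, hp.integral_density, mul_one, smoothed]

/-- Averages over the model, in terms of the likelihood ratio. -/
lemma integral_model {d n : ℕ} [NeZero d] {h : Outcome d n → ℝ} (hh : Measurable h) :
    ∫ ω, h ω ∂(model p d n)
      = ∫ q, (jointLik p q.1 q.2.1).toReal * h (assemble q) ∂((signalLaw d).prod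
        ((Measure.pi fun _ : Fin n => (sensingLaw d).prod (outLaw p)).prod (sensingLaw d))) := by
  have := hp.isProbabilityMeasure_outLaw
  have hJ : Measurable fun q : EuclideanSpace ℂ (Fin d) ×
      (Fin n → EuclideanSpace ℂ (Fin d) × ℝ) × EuclideanSpace ℂ (Fin d) =>
      jointLik p q.1 q.2.1 :=
    hp.measurable_jointLik.comp (f := fun q : EuclideanSpace ℂ (Fin d) ×
      (Fin n → EuclideanSpace ℂ (Fin d) × ℝ) × EuclideanSpace ℂ (Fin d) => (q.1, q.2.1))
      (by fun_prop)
  rw [hp.model_eq_map, integral_map measurable_assemble.aemeasurable hh.aestronglyMeasurable,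
    integral_withDensity_eq_integral_toReal_smul hJ]
  · rfl
  · have h1 := (hp.isProbabilityMeasure_model d n).measure_univ
    rw [hp.model_eq_map, Measure.map_apply measurable_assemble MeasurableSet.univ,
      Set.preimage_univ, withDensity_apply _ MeasurableSet.univ, Measure.restrict_univ] at h1
    exact ae_lt_top hJ (by rw [h1]; simp)

lemma integrable_jointLik {d n : ℕ} [NeZero d] :
    Integrable (fun q => (jointLik p q.1 q.2.1).toReal) ((signalLaw d).prod
        ((Measure.pi fun _ : Fin n => (sensingLaw d).prod (outLaw p)).prod (sensingLaw d))) := by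
  have := hp.isProbabilityMeasure_outLaw
  have hJ : Measurable fun q : EuclideanSpace ℂ (Fin d) ×
      (Fin n → EuclideanSpace ℂ (Fin d) × ℝ) × EuclideanSpace ℂ (Fin d) =>
      jointLik p q.1 q.2.1 :=
    hp.measurable_jointLik.comp (f := fun q : EuclideanSpace ℂ (Fin d) ×
      (Fin n → EuclideanSpace ℂ (Fin d) × ℝ) × EuclideanSpace ℂ (Fin d) => (q.1, q.2.1))
      (by fun_prop)
  refine integrable_toReal_of_lintegral_ne_top hJ.aemeasurable ?_
  have h1 := (hp.isProbabilityMeasure_model d n).measure_univ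
  rw [hp.model_eq_map, Measure.map_apply measurable_assemble MeasurableSet.univ,
    Set.preimage_univ, withDensity_apply _ MeasurableSet.univ, Measure.restrict_univ] at h1
  rw [h1]; simp

/-- The target is almost uncorrelated with every bounded function of the full data when the second
moment of the likelihood ratio increases by little with one more measurement. The new measurement,
of which the target is the conditional mean, takes the place of the target. -/
lemma abs_integral_target_sub_mul_le (hϕ : Measurable ϕ) {K : ℝ} (hK : ∀ y, |ϕ y| ≤ K)
    {d n : ℕ} [NeZero d] (hfin : secondMoment p d n ≠ ∞) {ε : ℝ} (hε : 0 ≤ ε)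
    (hinc : secondMoment p d (n + 1) ≤ secondMoment p d n + ENNReal.ofReal ε)
    {v : (Fin n → ℝ) × (Fin (n + 1) → EuclideanSpace ℂ (Fin d)) → ℝ} (hv : Measurable v)
    {C : ℝ} (hC : ∀ z, |v z| ≤ C) :
    |∫ ω, (target p ϕ d n ω - ∫ y, ϕ y ∂(outLaw p)) * v (fullData d n ω) ∂(model p d n)|
      ≤ C * (2 * K) * √ε := by
  have := hp.isProbabilityMeasure_outLaw
  set b := ∫ y, ϕ y ∂(outLaw p) with hb
  set τ := Measure.pi fun _ : Fin n => (sensingLaw d).prod (outLaw p) with hτ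
  set V : (Fin n → EuclideanSpace ℂ (Fin d) × ℝ) × EuclideanSpace ℂ (Fin d) → ℝ :=
    fun z => v (gather z).swap with hV
  have hVm : Measurable V := hv.comp (measurable_swap.comp measurable_gather)
  have hVC : ∀ z, |V z| ≤ C := fun z => hC _
  have hC0 : 0 ≤ C := (abs_nonneg _).trans (hC ((fun _ => 0), fun _ => 0))
  have hϕb : ∀ y, |ϕ y - b| ≤ 2 * K := fun y =>
    (abs_sub _ _).trans (by linarith [hK y, hp.abs_integral_outLaw_le hK])
  set w : (Fin n → EuclideanSpace ℂ (Fin d) × ℝ) × (EuclideanSpace ℂ (Fin d) × ℝ) → ℝ :=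
    fun z => V (z.1, z.2.1) * (ϕ z.2.2 - b) with hw
  have hwm : Measurable w := (hVm.comp (f := fun z : (Fin n → EuclideanSpace ℂ (Fin d) × ℝ) ×
      (EuclideanSpace ℂ (Fin d) × ℝ) => (z.1, z.2.1)) (by fun_prop)).mul
    ((hϕ.comp (measurable_snd.comp measurable_snd)).sub_const b)
  have hwC : ∀ z, |w z| ≤ C * (2 * K) := fun z => by
    rw [hw, abs_mul]
    exact mul_le_mul (hVC _) (hϕb _) (abs_nonneg _) hC0
  have hw0 : ∀ θ, ∫ c, w (θ, c) ∂((sensingLaw d).prod (outLaw p)) = 0 := by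
    intro θ
    have hwθ : Measurable fun c => w (θ, c) := hwm.comp measurable_prodMk_left
    rw [integral_prod _ (Integrable.of_bound hwθ.aestronglyMeasurable (C * (2 * K))
      (ae_of_all _ fun c => hwC (θ, c)))]
    simp only [hw, integral_const_mul]
    rw [integral_sub (hp.integrable_of_bounded_outLaw hϕ hK) (integrable_const b)]
    simp [hb]
  have key := abs_integral_mixture_le (μ := signalLaw d) (τ := τ)
    (β := (sensingLaw d).prod (outLaw p)) hp.measurable_jointLik hp.measurable_lik
    (hp.ae_lintegral_jointLik d n)
    ((ae_signalLaw_norm_sq d).mono fun x hx => hp.lintegral_lik (NeZero.pos d) hx)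
    (by rwa [hp.lintegral_jointLik_eq_secondMoment]) hε
    (by rwa [hp.lintegral_jointLik_eq_secondMoment, hp.lintegral_jointLik_mul_lik_eq_secondMoment])
    hwm hwC hw0
  refine le_of_eq_of_le (congrArg _ ?_) key
  have hfd : Measurable (fullData d n) := by unfold fullData; fun_prop
  have hZ : Measurable fun ω => (target p ϕ d n ω - b) * v (fullData d n ω) :=
    ((hp.measurable_target hϕ d n).sub_const b).mul (hv.comp hfd)
  have hZ' : Measurable fun q : EuclideanSpace ℂ (Fin d) ×
      (Fin n → EuclideanSpace ℂ (Fin d) × ℝ) × EuclideanSpace ℂ (Fin d) =>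
      (target p ϕ d n (assemble q) - b) * v (fullData d n (assemble q)) :=
    hZ.comp measurable_assemble
  have hZb : ∀ ω, |(target p ϕ d n ω - b) * v (fullData d n ω)| ≤ (2 * K) * C := fun ω => by
    rw [abs_mul]
    refine mul_le_mul ?_ (hC _) (abs_nonneg _) ?_
    · exact (abs_sub _ _).trans (by
        have := hp.norm_smoothed_le hK (absInner ω.1 (ω.2.1 (Fin.last n)))
        have := hp.abs_integral_outLaw_le hK
        unfold target
        linarith)
    · linarith [(abs_nonneg _).trans (hK 0)]
  have hZi : Integrable (fun q => (jointLik p q.1 q.2.1).toReal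
      * ((target p ϕ d n (assemble q) - b) * v (fullData d n (assemble q))))
      ((signalLaw d).prod (τ.prod (sensingLaw d))) :=
    hp.integrable_jointLik.mul_bdd (c := 2 * K * C) hZ'.aestronglyMeasurable
      (ae_of_all _ fun q => hZb _)
  have hJk := measurable_likelihood_mul (hp.measurable_jointLik (d := d) (n := n)) hp.measurable_lik
  have hWi : Integrable (fun q : EuclideanSpace ℂ (Fin d) × (Fin n → EuclideanSpace ℂ (Fin d) × ℝ) ×
      (EuclideanSpace ℂ (Fin d) × ℝ) => w q.2 * (jointLik p q.1 q.2.1 * lik p q.1 q.2.2).toReal)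
      ((signalLaw d).prod (τ.prod ((sensingLaw d).prod (outLaw p)))) := by
    refine Integrable.bdd_mul (c := C * (2 * K)) ?_ (hwm.comp measurable_snd).aestronglyMeasurable
      (ae_of_all _ fun q => hwC q.2)
    refine integrable_toReal_of_lintegral_ne_top hJk.aemeasurable ?_
    change ∫⁻ q, Function.uncurry (fun x (z : (Fin n → EuclideanSpace ℂ (Fin d) × ℝ) ×
      (EuclideanSpace ℂ (Fin d) × ℝ)) => jointLik p x z.1 * lik p x z.2) q
        ∂((signalLaw d).prod (τ.prod ((sensingLaw d).prod (outLaw p)))) ≠ ∞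
    rw [lintegral_prod _ hJk.aemeasurable]
    simp only [Function.uncurry_apply_pair]
    rw [lintegral_congr_ae (lintegral_likelihood_mul_eq_one hp.measurable_jointLik
      hp.measurable_lik (hp.ae_lintegral_jointLik d n)
      ((ae_signalLaw_norm_sq d).mono fun x hx => hp.lintegral_lik (NeZero.pos d) hx))]
    simp
  rw [hp.integral_model hZ, integral_prod _ hZi, integral_prod _ hWi]
  refine integral_congr_ae ?_
  filter_upwards [ae_signalLaw_norm_sq d, hWi.prod_right_ae] with x hx hxi
  have hassoc := measurePreserving_prodAssoc τ (sensingLaw d) (outLaw p)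
  have hxi' : Integrable (fun z : ((Fin n → EuclideanSpace ℂ (Fin d) × ℝ) ×
      EuclideanSpace ℂ (Fin d)) × ℝ => w (MeasurableEquiv.prodAssoc z)
        * (jointLik p x (MeasurableEquiv.prodAssoc z).1
          * lik p x (MeasurableEquiv.prodAssoc z).2).toReal)
      ((τ.prod (sensingLaw d)).prod (outLaw p)) :=
    hassoc.integrable_comp_of_integrable hxi
  rw [← hassoc.integral_comp' (g := fun z : (Fin n → EuclideanSpace ℂ (Fin d) × ℝ) ×
      (EuclideanSpace ℂ (Fin d) × ℝ) => w z * (jointLik p x z.1 * lik p x z.2).toReal),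
    integral_prod _ hxi']
  refine integral_congr_ae ?_
  filter_upwards [Measure.quasiMeasurePreserving_snd.ae
    (hp.ae_integral_sub_mul_lik hϕ hK b hx)] with z hz
  have h1 : target p ϕ d n (assemble (x, z)) = smoothed p ϕ (absInner x z.2) := by
    simp [target, assemble, gather]
  have h2 : v (fullData d n (assemble (x, z))) = V z := rfl
  simp only [h1, h2]
  rw [← hz, ← integral_mul_const, ← integral_const_mul]
  refine integral_congr_ae (ae_of_all _ fun y => ?_)
  simp only [MeasurableEquiv.prodAssoc, hw, ENNReal.toReal_mul, MeasurableEquiv.coe_mk,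
    Equiv.prodAssoc_apply]
  ring

end IsChannel

/-! ### The second moment below the threshold -/

/-- Negativity of `F` bounds `f` by a negative power of `1 - m`. -/
lemma f_le_of_F_neg {p : ℝ≥0 → ℝ → ℝ≥0} {δ m : ℝ} (hδ : 0 < δ) (hm : m < 1)
    (h : F p δ m < 0) : f p m ≤ ENNReal.ofReal ((1 - m) ^ (-δ⁻¹)) := by
  have h1 : 0 < 1 - m := by linarith
  rw [F, ENNReal.log_ofReal_of_pos h1] at h
  rcases eq_or_ne (f p m) 0 with h0 | h0
  · simp [h0]
  rcases eq_or_ne (f p m) ∞ with ht | ht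
  · rw [ht, ENNReal.log_top, EReal.coe_mul_top_of_pos hδ, EReal.top_add_coe] at h
    exact absurd h (by simp)
  rw [ENNReal.log_pos_real h0 ht] at h
  have h2 : δ * Real.log (f p m).toReal + Real.log (1 - m) < 0 := by exact_mod_cast h
  have hpos : 0 < (f p m).toReal := ENNReal.toReal_pos h0 ht
  rw [← ENNReal.ofReal_toReal ht]
  refine ENNReal.ofReal_le_ofReal ?_
  rw [← Real.log_le_log_iff hpos (Real.rpow_pos_of_pos h1 _), Real.log_rpow h1]
  have : Real.log (f p m).toReal < -Real.log (1 - m) / δ := by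
    rw [lt_div_iff₀ hδ]; linarith
  calc _ ≤ _ := this.le
    _ = _ := by field_simp

/-- Below the threshold the second moment of the likelihood ratio stays bounded: the overlap has
density proportional to `(1 - m) ^ (d - 2)`, which absorbs the power of `1 - m` that bounds
`f(m) ^ n`. -/
lemma secondMoment_le {p : ℝ≥0 → ℝ → ℝ≥0} {δ θ : ℝ} (hδ : 0 < δ)
    (hF : ∀ m ∈ Set.Ioc (0 : ℝ) 1, F p δ m < 0) (hθ0 : 0 < θ) (hθ : θ < 1) {d n : ℕ} (hn : 0 < n)
    (hnd : n / δ ≤ θ * d) (hd : 2 ≤ (1 - θ) * d) :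
    secondMoment p d n ≤ ENNReal.ofReal (2 / (1 - θ)) := by
  have h1θ : 0 < 1 - θ := by linarith
  have hd2 : (2 : ℝ) ≤ d := by nlinarith [(Nat.cast_nonneg d : (0 : ℝ) ≤ d)]
  obtain ⟨k, rfl⟩ : ∃ k, d = k + 1 := Nat.exists_eq_succ_of_ne_zero (by
    rintro rfl; norm_num at hd2)
  have hk : k ≠ 0 := by rintro rfl; norm_num at hd2
  set s : ℝ := n / δ with hs
  have hs0 : 0 < s := by positivity
  push_cast at hnd hd
  have hks : (1 - θ) * (k + 1) / 2 ≤ k - s := by linarith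
  have hks0 : 0 < (k : ℝ) - s := lt_of_lt_of_le (by positivity) hks
  have key : ∀ᵐ x ∂(signalLaw (k + 1)), ∫⁻ x', f p (overlap x x') ^ n ∂(signalLaw (k + 1))
      ≤ ENNReal.ofReal (2 / (1 - θ)) := by
    filter_upwards [ae_signalLaw_norm_sq (k + 1)] with x hx
    calc ∫⁻ x', f p (overlap x x') ^ n ∂(signalLaw (k + 1))
        ≤ ∫⁻ x', ENNReal.ofReal ((1 - overlap x x') ^ (-s)) ∂(signalLaw (k + 1)) := by
          refine lintegral_mono_ae ?_
          filter_upwards [ae_overlap_mem_Ioo rfl hk hx] with x' hx'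
          have h1 : 0 < 1 - overlap x x' := by linarith [hx'.2]
          refine (pow_le_pow_left' (f_le_of_F_neg hδ hx'.2 (hF _ ⟨hx'.1, hx'.2.le⟩)) n).trans_eq ?_
          rw [← ENNReal.ofReal_pow (Real.rpow_nonneg h1.le _), ← Real.rpow_natCast,
            ← Real.rpow_mul h1.le]
          congr 2
          rw [hs]; ring
      _ ≤ ENNReal.ofReal (k / (k - s)) :=
          lintegral_one_sub_overlap_rpow_le rfl hx hs0 (by linarith)
      _ ≤ ENNReal.ofReal (2 / (1 - θ)) := by
          refine ENNReal.ofReal_le_ofReal ?_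
          rw [div_le_div_iff₀ hks0 h1θ]
          nlinarith
  calc secondMoment p (k + 1) n ≤ ∫⁻ _, ENNReal.ofReal (2 / (1 - θ)) ∂(signalLaw (k + 1)) :=
        lintegral_mono_ae key
    _ = _ := by simp

lemma nat_mul_pow_succ_le (a : ℝ≥0∞) (n : ℕ) {j : ℕ} (hj : j ≠ 0) :
    j * a ^ (n + 1) ≤ a ^ (n + j) + j * a ^ n := by
  rcases eq_or_ne a ∞ with rfl | ha
  · rw [ENNReal.top_pow (by omega : n + j ≠ 0), top_add]
    exact le_top
  lift a to ℝ≥0 using ha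
  have h := one_add_mul_sub_le_pow (a := (a : ℝ)) (by linarith [a.coe_nonneg]) j
  have h2 : (j : ℝ) * (a : ℝ) ^ (n + 1) ≤ (a : ℝ) ^ (n + j) + j * (a : ℝ) ^ n := by
    have := mul_le_mul_of_nonneg_left h (pow_nonneg a.coe_nonneg n)
    rw [← pow_add] at this
    have h3 : 0 ≤ (a : ℝ) ^ n := pow_nonneg a.coe_nonneg n
    rw [pow_succ]
    linarith
  exact_mod_cast h2

namespace IsChannel

variable {p : ℝ≥0 → ℝ → ℝ≥0} (hp : IsChannel p)
include hp

/-- Convexity of the second moment in the number of measurements: by Bernoulli's inequality, `j`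
times its increment at `n` is at most the second moment `j` steps later. -/
lemma nat_mul_secondMoment_succ_le (d n : ℕ) [NeZero d] {j : ℕ} (hj : j ≠ 0) :
    j * secondMoment p d (n + 1) ≤ secondMoment p d (n + j) + j * secondMoment p d n := by
  have := hp.isProbabilityMeasure_outLaw
  set R : EuclideanSpace ℂ (Fin d) × EuclideanSpace ℂ (Fin d) → ℝ≥0∞ :=
    fun z => ∫⁻ b, lik p z.1 b * lik p z.2 b ∂((sensingLaw d).prod (outLaw p)) with hR
  have hRm : Measurable R := by
    refine Measurable.lintegral_prod_right' (f := fun w : (EuclideanSpace ℂ (Fin d) ×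
      EuclideanSpace ℂ (Fin d)) × (EuclideanSpace ℂ (Fin d) × ℝ) =>
        lik p w.1.1 w.2 * lik p w.1.2 w.2) ?_
    exact (hp.measurable_lik.comp (f := fun w : (EuclideanSpace ℂ (Fin d) ×
      EuclideanSpace ℂ (Fin d)) × (EuclideanSpace ℂ (Fin d) × ℝ) => (w.1.1, w.2))
        (by fun_prop)).mul (hp.measurable_lik.comp (f := fun w : (EuclideanSpace ℂ (Fin d) ×
      EuclideanSpace ℂ (Fin d)) × (EuclideanSpace ℂ (Fin d) × ℝ) => (w.1.2, w.2)) (by fun_prop))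
  have hS : ∀ i, secondMoment p d i = ∫⁻ z, R z ^ i ∂((signalLaw d).prod (signalLaw d)) := by
    intro i
    rw [lintegral_prod _ (hRm.pow_const i).aemeasurable]
    refine lintegral_congr_ae ?_
    filter_upwards [ae_signalLaw_norm_sq d] with x hx
    refine lintegral_congr_ae ?_
    filter_upwards [ae_signalLaw_norm_sq d] with x' hx'
    rw [hR, ← hp.lintegral_lik_mul_lik (NeZero.pos d) hx hx']
  rw [hS, hS, hS, ← lintegral_const_mul _ (hRm.pow_const _),
    ← lintegral_const_mul _ (hRm.pow_const _),
    ← lintegral_add_right _ ((hRm.pow_const _).const_mul _)]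
  exact lintegral_mono fun z => nat_mul_pow_succ_le _ _ hj

end IsChannel

/-- Below the threshold, the increment of the second moment of the likelihood ratio at the
`n`-th measurement tends to `0`. -/
lemma exists_tendsto_secondMoment_increment {p : ℝ≥0 → ℝ → ℝ≥0} (hp : IsChannel p) {δ : ℝ}
    (hδ : 0 < δ) (hδl : ENNReal.ofReal δ < deltaL p) {d : ℕ → ℕ}
    (hd : Tendsto (fun n : ℕ => (n : ℝ) / (d n : ℝ)) atTop (𝓝 δ)) :
    ∃ ε : ℕ → ℝ, Tendsto ε atTop (𝓝 0) ∧ ∀ᶠ n in atTop, d n ≠ 0 ∧ 0 ≤ ε n ∧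
      secondMoment p (d n) n ≠ ∞ ∧
      secondMoment p (d n) (n + 1) ≤ secondMoment p (d n) n + ENNReal.ofReal (ε n) := by
  obtain ⟨_, ⟨δ', hδ', hF, rfl⟩, hlt⟩ := lt_sSup_iff.1 hδl
  have hδδ' : δ < δ' := (ENNReal.ofReal_lt_ofReal_iff hδ').1 hlt
  -- `δ < ρ₁ < ρ₂ < δ'`: `n ≤ ρ₁ d` eventually, and `n` is increased up to `ρ₂ d`
  obtain ⟨ρ₂, hρ₂, hρ₂'⟩ := exists_between hδδ'
  obtain ⟨ρ₁, hρ₁, hρ₁'⟩ := exists_between hρ₂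
  set θ := ρ₂ / δ' with hθ
  have hθ0 : 0 < θ := by rw [hθ]; exact div_pos (by linarith) hδ'
  have hθ1 : θ < 1 := (div_lt_one hδ').2 hρ₂'
  have hdpos : ∀ᶠ n : ℕ in atTop, d n ≠ 0 := by
    filter_upwards [hd.eventually_const_lt hδ] with n hn h0
    simp [h0] at hn
  have hdinf : Tendsto (fun n => (d n : ℝ)) atTop atTop := by
    have h1 : Tendsto (fun n : ℕ => (n : ℝ) * ((n : ℝ) / (d n : ℝ))⁻¹) atTop atTop :=
      tendsto_natCast_atTop_atTop.atTop_mul_pos (inv_pos.2 hδ) (hd.inv₀ hδ.ne')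
    refine h1.congr' ?_
    filter_upwards [hdpos, eventually_gt_atTop 0] with n hn hn0
    have : (d n : ℝ) ≠ 0 := by exact_mod_cast hn
    have : (n : ℝ) ≠ 0 := by positivity
    field_simp
  set j : ℕ → ℕ := fun n => ⌊(ρ₂ - ρ₁) * d n⌋₊ with hj
  have hjinf : Tendsto j atTop atTop :=
    tendsto_nat_floor_atTop.comp (hdinf.const_mul_atTop (by linarith))
  refine ⟨fun n => 2 / (1 - θ) / j n, ?_, ?_⟩
  · exact tendsto_const_nhds.div_atTop (tendsto_natCast_atTop_atTop.comp hjinf)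
  filter_upwards [hdpos, hd.eventually_lt_const hρ₁, hjinf.eventually_gt_atTop 0,
    (hdinf.const_mul_atTop (sub_pos.2 hθ1)).eventually_ge_atTop 2, eventually_gt_atTop 0]
    with n hn hn1 hjn hd2 hn0
  have : NeZero (d n) := ⟨hn⟩
  have hd0 : (0 : ℝ) < d n := by positivity
  have hnd : (n : ℝ) ≤ ρ₁ * d n := ((div_lt_iff₀ hd0).1 hn1).le
  have hjd : (j n : ℝ) ≤ (ρ₂ - ρ₁) * d n :=
    Nat.floor_le (mul_nonneg (by linarith) hd0.le)
  have hC : 0 ≤ 2 / (1 - θ) := div_nonneg (by norm_num) (by linarith)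
  have hθd : θ * d n = ρ₂ * d n / δ' := by rw [hθ]; ring
  have hb1 := secondMoment_le (n := n) hδ' hF hθ0 hθ1 hn0 (by
    rw [hθd]; gcongr; nlinarith) hd2
  have hb2 := secondMoment_le (n := n + j n) hδ' hF hθ0 hθ1 (by omega) (by
    rw [hθd]; push_cast; gcongr; nlinarith) hd2
  refine ⟨hn, by positivity, ne_top_of_le_ne_top (by simp) hb1, ?_⟩
  have h := hp.nat_mul_secondMoment_succ_le (d n) n hjn.ne'
  have hj0 : (j n : ℝ≥0∞) ≠ 0 := by exact_mod_cast hjn.ne'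
  have hjt : (j n : ℝ≥0∞) ≠ ∞ := ENNReal.natCast_ne_top _
  rw [← ENNReal.mul_le_mul_iff_right hj0 hjt, mul_add]
  refine h.trans ?_
  rw [add_comm]
  gcongr
  refine hb2.trans_eq ?_
  rw [← ENNReal.ofReal_natCast, ← ENNReal.ofReal_mul (Nat.cast_nonneg _)]
  congr 1
  have : (j n : ℝ) ≠ 0 := by exact_mod_cast hjn.ne'
  field_simp

/-! ### Minimum mean square errors -/

section CondExp

variable {Ω β : Type*} {m m₀ : MeasurableSpace Ω} [MeasurableSpace β] {μ : Measure Ω}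
  [IsProbabilityMeasure μ]

/-- If a bounded variable `Z` is almost uncorrelated, after centering at `b`, with the bounded
functions of the data `D`, then its conditional expectation given any coarser `σ`-algebra has small
variance. -/
lemma variance_condExp_le {Z : Ω → ℝ} (hZ : Measurable Z) {K : ℝ}
    (hK : ∀ ω, |Z ω| ≤ K) {b : ℝ} (hb : |b| ≤ K) {D : Ω → β} (hD : Measurable D) {η : ℝ}
    (h : ∀ v : β → ℝ, Measurable v → (∀ z, |v z| ≤ 2 * K) → |∫ ω, (Z ω - b) * v (D ω) ∂μ| ≤ η)
    (hm : m ≤ MeasurableSpace.comap D inferInstance) :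
    Var[μ[Z | m]; μ] ≤ η := by
  have hm0 : m ≤ m₀ := hm.trans hD.comap_le
  have hK0 : 0 ≤ K := (abs_nonneg _).trans hb
  have hZi : Integrable Z μ := Integrable.of_bound hZ.aestronglyMeasurable K (ae_of_all _ hK)
  set V := μ[Z | m] with hV
  have hVm : StronglyMeasurable[m] V := stronglyMeasurable_condExp
  have hVK : ∀ᵐ ω ∂μ, |V ω| ≤ K := by
    have := ae_bdd_abs_condExp_of_ae_bdd_abs (m := m) (μ := μ) (R := K) (ae_of_all _ hK)
    exact this
  have hVm0 : Measurable V := (hVm.mono hm0).measurable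
  obtain ⟨g, hg, hgV⟩ := (hVm.measurable.mono hm le_rfl).exists_eq_measurable_comp
  -- the conditional expectation as a function of the data, truncated at `K` and centered
  set v : β → ℝ := fun z => max (-K) (min K (g z)) - b with hv
  have hvm : Measurable v := (measurable_const.max (measurable_const.min hg)).sub_const b
  have hvK : ∀ z, |v z| ≤ 2 * K := fun z => by
    have h1 : |max (-K) (min K (g z))| ≤ K :=
      abs_le.2 ⟨le_max_left _ _, max_le (by linarith) (min_le_left _ _)⟩
    exact (abs_sub _ _).trans (by linarith)
  have hvV : ∀ᵐ ω ∂μ, v (D ω) = V ω - b := by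
    filter_upwards [hVK] with ω hω
    have h1 : g (D ω) = V ω := (congrFun hgV ω).symm
    rw [abs_le] at hω
    simp only [hv, h1, min_eq_right hω.2, max_eq_right hω.1]
  have hZbi : Integrable (fun ω => Z ω - b) μ := hZi.sub (integrable_const b)
  have hVbK : ∀ᵐ ω ∂μ, ‖V ω - b‖ ≤ 2 * K := by
    filter_upwards [hVK] with ω hω
    exact (abs_sub _ _).trans (by linarith)
  have hVbm : StronglyMeasurable[m] fun ω => V ω - b := hVm.sub stronglyMeasurable_const
  have hprod : Integrable ((fun ω => Z ω - b) * fun ω => V ω - b) μ :=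
    hZbi.mul_bdd (c := 2 * K) (hVm0.sub_const b).aestronglyMeasurable hVbK
  have hcond : μ[fun ω => Z ω - b | m] =ᵐ[μ] fun ω => V ω - b := by
    have h1 := condExp_sub (m := m) hZi (integrable_const (μ := μ) b)
    rw [condExp_const hm0] at h1
    exact h1
  have hpull := condExp_mul_of_stronglyMeasurable_right hVbm hprod hZbi
  have hsq : ∫ ω, (V ω - b) ^ 2 ∂μ = ∫ ω, (Z ω - b) * v (D ω) ∂μ := by
    calc ∫ ω, (V ω - b) ^ 2 ∂μ = ∫ ω, (μ[(fun ω => Z ω - b) * fun ω => V ω - b | m]) ω ∂μ := by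
          refine integral_congr_ae ?_
          filter_upwards [hcond, hpull] with ω h1 h2
          rw [h2, Pi.mul_apply, h1, sq]
      _ = ∫ ω, (Z ω - b) * (V ω - b) ∂μ := integral_condExp hm0
      _ = ∫ ω, (Z ω - b) * v (D ω) ∂μ := by
          refine integral_congr_ae ?_
          filter_upwards [hvV] with ω h1
          rw [h1]
  calc Var[V; μ] = Var[fun ω => V ω - b; μ] :=
        (variance_sub_const hVm0.aestronglyMeasurable b).symm
    _ ≤ ∫ ω, (V ω - b) ^ 2 ∂μ := by
        have := variance_le_expectation_sq (μ := μ) (hVm0.sub_const b).aestronglyMeasurable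
        exact this
    _ ≤ η := by rw [hsq]; exact (le_abs_self _).trans (h v hvm hvK)

/-- The mean square error of the conditional expectation, by the law of total variance. -/
lemma integral_sub_condExp_sq {Z : Ω → ℝ} (hZ : MemLp Z 2 μ) (hm : m ≤ m₀) :
    ∫ ω, (Z ω - (μ[Z | m]) ω) ^ 2 ∂μ = Var[Z; μ] - Var[μ[Z | m]; μ] := by
  rw [← integral_condVar_add_variance_condExp hm hZ, add_sub_cancel_right]
  exact (integral_condExp hm).symm

end CondExp

/-- The minimum mean square error given data coarser than the full data is close to the variance of
the target, when the second moment of the likelihood ratio increases by little. -/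
lemma mmse_mem_Icc {p : ℝ≥0 → ℝ → ℝ≥0} (hp : IsChannel p) {ϕ : ℝ → ℝ} (hϕ : Measurable ϕ)
    {K : ℝ} (hK : ∀ y, |ϕ y| ≤ K) {d n : ℕ} [NeZero d] (hfin : secondMoment p d n ≠ ∞) {ε : ℝ}
    (hε : 0 ≤ ε) (hinc : secondMoment p d (n + 1) ≤ secondMoment p d n + ENNReal.ofReal ε)
    {β : Type} [MeasurableSpace β] {obs : Outcome d n → β}
    (hobs : MeasurableSpace.comap obs inferInstance
      ≤ MeasurableSpace.comap (fullData d n) inferInstance) :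
    mmse p ϕ d n obs ∈ Set.Icc
      (Var[fun g : ℂ => smoothed p ϕ ‖g‖₊; complexNormal 1] - 2 * K * (2 * K) * √ε)
      (Var[fun g : ℂ => smoothed p ϕ ‖g‖₊; complexNormal 1]) := by
  have := hp.isProbabilityMeasure_model d n
  have hZ := hp.measurable_target hϕ d n
  have hZK : ∀ ω, |target p ϕ d n ω| ≤ K := fun ω => hp.norm_smoothed_le hK _
  have hD : Measurable (fullData d n) := by unfold fullData; fun_prop
  have hZ2 : MemLp (target p ϕ d n) 2 (model p d n) :=
    MemLp.of_bound hZ.aestronglyMeasurable K (ae_of_all _ hZK)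
  have hle : Var[(model p d n)[target p ϕ d n | MeasurableSpace.comap obs inferInstance];
      model p d n] ≤ 2 * K * (2 * K) * √ε :=
    variance_condExp_le hZ hZK (hp.abs_integral_outLaw_le hK) hD
      (fun v hv hvK => hp.abs_integral_target_sub_mul_le hϕ hK hfin hε hinc hv hvK) hobs
  have heq : mmse p ϕ d n obs = _ := integral_sub_condExp_sq hZ2 (hobs.trans hD.comap_le)
  rw [heq, hp.variance_target hϕ]
  have hvn : 0 ≤ Var[(model p d n)[target p ϕ d n | MeasurableSpace.comap obs inferInstance];
      model p d n] := variance_nonneg _ _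
  exact ⟨by linarith, by linarith⟩

lemma comap_pastData_le (d n : ℕ) :
    MeasurableSpace.comap (pastData d n) inferInstance
      ≤ MeasurableSpace.comap (fullData d n) inferInstance := by
  have hg : Measurable fun z : (Fin n → ℝ) × (Fin (n + 1) → EuclideanSpace ℂ (Fin d)) =>
      (z.1, fun i : Fin n => z.2 i.castSucc) := by fun_prop
  have h : pastData d n = (fun z : (Fin n → ℝ) × (Fin (n + 1) → EuclideanSpace ℂ (Fin d)) =>
      (z.1, fun i : Fin n => z.2 i.castSucc)) ∘ fullData d n := rfl
  rw [h, ← MeasurableSpace.comap_comp]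
  exact MeasurableSpace.comap_mono hg.comap_le

end PhaseSensing

theorem theorem1 (p : ℝ≥0 → ℝ → ℝ≥0) (hp : PhaseSensing.IsChannel p)
    (ϕ : ℝ → ℝ) (hϕm : Measurable ϕ) (hϕb : ∃ K : ℝ, ∀ y, |ϕ y| ≤ K)
    (δ : ℝ) (hδ : 0 < δ) (hδl : ENNReal.ofReal δ < PhaseSensing.deltaL p)
    (d : ℕ → ℕ) (hd : Tendsto (fun n : ℕ => (n : ℝ) / (d n : ℝ)) atTop (𝓝 δ)) :
    (∀ n, 0 < d n →
      Var[PhaseSensing.target p ϕ (d n) n; PhaseSensing.model p (d n) n]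
        = Var[fun g : ℂ => PhaseSensing.smoothed p ϕ ‖g‖₊; PhaseSensing.complexNormal 1]) ∧
    Tendsto (fun n => PhaseSensing.mmse p ϕ (d n) n (PhaseSensing.pastData (d n) n)) atTop
      (𝓝 (Var[fun g : ℂ => PhaseSensing.smoothed p ϕ ‖g‖₊; PhaseSensing.complexNormal 1])) ∧
    Tendsto (fun n => PhaseSensing.mmse p ϕ (d n) n (PhaseSensing.fullData (d n) n)) atTop
      (𝓝 (Var[fun g : ℂ => PhaseSensing.smoothed p ϕ ‖g‖₊; PhaseSensing.complexNormal 1])) := by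
  obtain ⟨K, hK⟩ := hϕb
  obtain ⟨ε, hε0, hε⟩ := PhaseSensing.exists_tendsto_secondMoment_increment hp hδ hδl hd
  set v := Var[fun g : ℂ => PhaseSensing.smoothed p ϕ ‖g‖₊; PhaseSensing.complexNormal 1]
  have hlow : Tendsto (fun n => v - 2 * K * (2 * K) * √(ε n)) atTop (𝓝 v) := by
    simpa using (hε0.sqrt.const_mul (2 * K * (2 * K))).const_sub v
  refine ⟨fun n hn => ?_, ?_, ?_⟩
  · have : NeZero (d n) := ⟨hn.ne'⟩
    exact hp.variance_target hϕm (d n) n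
  · have hmem : ∀ᶠ n in atTop, PhaseSensing.mmse p ϕ (d n) n (PhaseSensing.pastData (d n) n)
        ∈ Set.Icc (v - 2 * K * (2 * K) * √(ε n)) v := by
      filter_upwards [hε] with n ⟨hn, h0, hfin, hinc⟩
      have : NeZero (d n) := ⟨hn⟩
      exact PhaseSensing.mmse_mem_Icc hp hϕm hK hfin h0 hinc
        (PhaseSensing.comap_pastData_le (d n) n)
    exact tendsto_of_tendsto_of_tendsto_of_le_of_le' hlow tendsto_const_nhds
      (hmem.mono fun _ h => h.1) (hmem.mono fun _ h => h.2)
  · have hmem : ∀ᶠ n in atTop, PhaseSensing.mmse p ϕ (d n) n (PhaseSensing.fullData (d n) n)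
        ∈ Set.Icc (v - 2 * K * (2 * K) * √(ε n)) v := by
      filter_upwards [hε] with n ⟨hn, h0, hfin, hinc⟩
      have : NeZero (d n) := ⟨hn⟩
      exact PhaseSensing.mmse_mem_Icc hp hϕm hK hfin h0 hinc le_rfl
    exact tendsto_of_tendsto_of_tendsto_of_le_of_le' hlow tendsto_const_nhds
      (hmem.mono fun _ h => h.1) (hmem.mono fun _ h => h.2)
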